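/- Let $K\subset\mathbb{R}^2$ be an open polygon, i.e. the bounded open region enclosed by a simple closed polygonal line with vertices $a_1,\dots,a_n$ ($n\ge 3$, cyclic order), and suppose $K$ is star-shaped with respect to some ball. Let $k\ge 2$. Let $\mathbb{P}_m$ be the polynomials of total degree $\le m$ in $x=(x_1,x_2)$ (with $\mathbb{P}_{-1}=\{0\}$), let $\mathcal{G}_m^\perp=\mathbf{x}^\perp\mathbb{P}_{m-1}\subseteq[\mathbb{P}_m]^2$ with $\mathbf{x}^\perp=(x_2,-x_1)$, and let $\mathcal{G}_k^\perp/\mathcal{G}_{k-2}^\perp$ denote the elements of $\mathcal{G}_k^\perp$ that are $L^2(K)$-orthogonal to $\mathcal{G}_{k-2}^\perp$. Let $\mathbb{B}_k(\partial K)$ be the continuous functions on $\partial K$ that are polynomials of degree $\le k$ on each edge. For $\mathbf{v}\in[H^1(K)]^2$ let $\Pi_k^{\nabla}\mathbf{v}\in[\mathbb{P}_k]^2$ be given by $\int_K\nabla\mathbf{q}:\nabla(\mathbf{v}-\Pi_k^{\nabla}\mathbf{v})=0$ for all $\mathbf{q}\in[\mathbb{P}_k]^2$ and $\int_K(\mathbf{v}-\Pi_k^{\nabla}\mathbf{v})=\mathbf{0}$,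 and let $\Pi_k^{0,K}\mathbf{v}\in[\mathbb{P}_k]^2$ be its $L^2(K)$-projection. The enhanced virtual element space $\mathbf{V}_h^K$ consists of all $\mathbf{v}\in[H^1(K)]^2$ such that $\mathbf{v}|_{\partial K}\in[\mathbb{B}_k(\partial K)]^2$ (trace), $-\Delta\mathbf{v}-\nabla s\in\mathcal{G}_k^\perp$ in the sense of distributions for some $s\in L^2(K)$, $\operatorname{div}\mathbf{v}\in\mathbb{P}_{k-1}$, and $\int_K(\mathbf{v}-\Pi_k^{\nabla}\mathbf{v})\cdot\mathbf{g}=0$ for all $\mathbf{g}\in\mathcal{G}_k^\perp/\mathcal{G}_{k-2}^\perp$. Choose $k-1$ distinct points in the interior of each edge, a finite family $(\mathbf{b}_j)$ spanning $\mathcal{G}_{k-2}^\perp$, and a finite family $(q_j)$ in $\mathbb{P}_{k-1}$ which together with the constant $1$ spans $\mathbb{P}_{k-1}$. The degrees of freedom $\mathbf{D}_V(\mathbf{v})=(D_j(\mathbf{v}))_j$ are: (D1) the values of $\mathbf{v}$ at the vertices; (D2) the values of $\mathbf{v}$ at the chosen edge points; (D3) the moments $\int_K\mathbf{v}\cdot\mathbf{b}_j$;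 (D4) the moments $\int_K(\operatorname{div}\mathbf{v})\,q_j$. Let $F\subseteq\mathbb{R}$ be the field generated by the coordinates of the vertices and of the edge points and the coefficients of all $\mathbf{b}_j$ and $q_j$. Then the degrees of freedom $\mathbf{D}_V$ allow one to compute exactly the $L^2$-projection $\Pi_k^{0,K}:\mathbf{V}_h^K\to[\mathbb{P}_k]^2$, linearly and by rational operations on the known data: (i) there are $\mathbf{B}_j\in[\mathbb{P}_k]^2$ with coefficients in $F$, not depending on $\mathbf{v}$, such that $\Pi_k^{0,K}\mathbf{v}=\sum_j D_j(\mathbf{v})\,\mathbf{B}_j$ for all $\mathbf{v}\in\mathbf{V}_h^K$; (ii) for every $\mathbf{q}\in[\mathbb{P}_k]^2$ there are real numbers $A_j$, not depending on $\mathbf{v}$, and lying in $F$ whenever the coefficients of $\mathbf{q}$ do, such that $\int_K\mathbf{v}\cdot\mathbf{q}=\sum_j A_j\,D_j(\mathbf{v})$ for all $\mathbf{v}\in\mathbf{V}_h^K$. -/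

import Mathlib

open MeasureTheory Filter Topology
open scoped ContDiff

namespace VEM

/-- The plane with its Euclidean norm and Lebesgue measure. -/
abbrev Plane : Type := EuclideanSpace ℝ (Fin 2)

/-- Real polynomials in the two coordinates. -/
abbrev Poly : Type := MvPolynomial (Fin 2) ℝ

/-- The value of a polynomial at a point of the plane. -/
noncomputable def ev (p : Poly) (x : Plane) : ℝ := MvPolynomial.eval (fun i => x i) p

/-- Polynomials of total degree at most `m`; for `m = -1` this is the zero space. -/
noncomputable def polyLE (m : ℤ) : Submodule ℝ Poly :=
  MvPolynomial.restrictSupport ℝ {e : Fin 2 →₀ ℕ | (e.degree : ℤ) ≤ m}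

/-- The map `p ↦ x^⊥ p = (x₂ p, -x₁ p)`. -/
noncomputable def xPerp : Poly →ₗ[ℝ] (Fin 2 → Poly) :=
  LinearMap.pi ![LinearMap.mulLeft ℝ (MvPolynomial.X 1 : Poly),
    -LinearMap.mulLeft ℝ (MvPolynomial.X 0 : Poly)]

/-- The space `G_m^⊥ = x^⊥ [P_{m-1}]`. -/
noncomputable def gPerp (m : ℤ) : Submodule ℝ (Fin 2 → Poly) := (polyLE (m - 1)).map xPerp

/-! ### Polygons -/

/-- The closed edge from the `i`-th vertex to the next one (cyclically). -/
def edge {n : ℕ} [NeZero n] (a : Fin n → Plane) (i : Fin n) : Set Plane :=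
  segment ℝ (a i) (a (i + 1))

/-- `K` is the open region enclosed by the simple closed polygonal line with the vertices `a`,
listed in cyclic order (either orientation; straight angles are allowed). -/
structure IsPolygon {n : ℕ} [NeZero n] (a : Fin n → Plane) (K : Set Plane) : Prop where
  three_le : 3 ≤ n
  injective : Function.Injective a
  adjacent : ∀ i, edge a i ∩ edge a (i + 1) = {a (i + 1)}
  disjoint : ∀ i j, j ≠ i → j ≠ i + 1 → i ≠ j + 1 → Disjoint (edge a i) (edge a j)
  isOpen : IsOpen K
  nonempty : K.Nonempty
  isBounded : Bornology.IsBounded K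
  frontier_eq : frontier K = ⋃ i, edge a i

/-- `K` is star-shaped with respect to some ball of positive radius. -/
def StarShapedBall (K : Set Plane) : Prop :=
  ∃ (c : Plane) (r : ℝ), 0 < r ∧ Metric.ball c r ⊆ K ∧
    ∀ y ∈ Metric.ball c r, StarConvex ℝ y K

/-! ### Weak derivatives, `H¹` and traces -/

/-- The classical `j`-th partial derivative. -/
noncomputable def pd (j : Fin 2) (f : Plane → ℝ) (x : Plane) : ℝ :=
  fderiv ℝ f x (EuclideanSpace.single j 1)

/-- Test functions: smooth with compact support in `K`. -/
def IsTest (K : Set Plane) (f : Plane → ℝ) : Prop :=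
  ContDiff ℝ ∞ f ∧ HasCompactSupport f ∧ tsupport f ⊆ K

/-- `w ∈ L²(K)` is the `j`-th distributional derivative of `u` in `K`. -/
def IsWeakPartial (K : Set Plane) (j : Fin 2) (u w : Plane → ℝ) : Prop :=
  MemLp w 2 (volume.restrict K) ∧
    ∀ f, IsTest K f → ∫ x in K, u x * pd j f x = -∫ x in K, w x * f x

/-- Membership in `H¹(K)`. -/
def IsH1 (K : Set Plane) (u : Plane → ℝ) : Prop :=
  MemLp u 2 (volume.restrict K) ∧ ∀ j, ∃ w, IsWeakPartial K j u w

open Classical in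
/-- The `j`-th weak derivative (unique almost everywhere in `K`; zero if there is none). -/
noncomputable def weakPartial (K : Set Plane) (j : Fin 2) (u : Plane → ℝ) : Plane → ℝ :=
  if h : ∃ w, IsWeakPartial K j u w then h.choose else 0

/-- The weak divergence. -/
noncomputable def weakDiv (K : Set Plane) (v : Fin 2 → Plane → ℝ) (x : Plane) : ℝ :=
  ∑ i, weakPartial K i (v i) x

/-- `g` is the trace of `u ∈ H¹(K)` on `∂K`: functions that are smooth up to the boundary converge
to `u` in `H¹(K)` while their boundary values converge to `g` in `L²` of every edge. -/
def HasTrace {n : ℕ} [NeZero n] (a : Fin n → Plane) (K : Set Plane) (u g : Plane → ℝ) : Prop :=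
  ∃ f : ℕ → Plane → ℝ, (∀ N, ContDiff ℝ ∞ (f N)) ∧
    Tendsto (fun N => eLpNorm (fun x => u x - f N x) 2 (volume.restrict K)) atTop (𝓝 0) ∧
    (∀ j, Tendsto (fun N => eLpNorm (fun x => weakPartial K j u x - pd j (f N) x) 2
      (volume.restrict K)) atTop (𝓝 0)) ∧
    ∀ i, Tendsto (fun N => eLpNorm (fun t : ℝ =>
        g (AffineMap.lineMap (a i) (a (i + 1)) t) - f N (AffineMap.lineMap (a i) (a (i + 1)) t)) 2
      (volume.restrict (Set.Icc (0 : ℝ) 1))) atTop (𝓝 0)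

/-- The space `B_k(∂K)`: continuous on `∂K` and a polynomial of degree at most `k` on every edge. -/
def IsBoundaryPoly {n : ℕ} [NeZero n] (a : Fin n → Plane) (K : Set Plane) (k : ℕ)
    (g : Plane → ℝ) : Prop :=
  ContinuousOn g (frontier K) ∧ ∀ i, ∃ p ∈ polyLE k, ∀ x ∈ edge a i, g x = ev p x

/-- The boundary values of the vector field `v` are the piecewise polynomial field `g`. -/
def HasBoundaryValues {n : ℕ} [NeZero n] (a : Fin n → Plane) (K : Set Plane) (k : ℕ)
    (v g : Fin 2 → Plane → ℝ) : Prop :=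
  ∀ i, IsBoundaryPoly a K k (g i) ∧ HasTrace a K (v i) (g i)

/-! ### Projections -/

/-- The polynomial field `π` is the `L²(K)`-projection of `v` onto `[P_m(K)]²`. -/
def IsL2Projection (K : Set Plane) (m : ℕ) (v : Fin 2 → Plane → ℝ) (π : Fin 2 → Poly) : Prop :=
  (∀ i, π i ∈ polyLE m) ∧ ∀ q : Fin 2 → Poly, (∀ i, q i ∈ polyLE m) →
    ∫ x in K, ∑ i, ev (q i) x * (v i x - ev (π i) x) = 0

/-- The polynomial field `π` is the `H¹`-seminorm projection of `v` onto `[P_k(K)]²`. -/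
def IsEnergyProjection (K : Set Plane) (k : ℕ) (v : Fin 2 → Plane → ℝ) (π : Fin 2 → Poly) : Prop :=
  (∀ i, π i ∈ polyLE k) ∧
    (∀ q : Fin 2 → Poly, (∀ i, q i ∈ polyLE k) →
      ∫ x in K, ∑ i, ∑ j, ev (MvPolynomial.pderiv j (q i)) x *
        (weakPartial K j (v i) x - ev (MvPolynomial.pderiv j (π i)) x) = 0) ∧
    IsL2Projection K 0 (fun i x => v i x - ev (π i) x) 0

/-! ### The virtual element spaces -/

/-- `-Δv - ∇s = h` in `K` in the sense of distributions. -/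
def SolvesStokes (K : Set Plane) (v : Fin 2 → Plane → ℝ) (s : Plane → ℝ) (h : Fin 2 → Poly) :
    Prop :=
  ∀ i, ∀ f, IsTest K f →
    ∫ x in K, (-(v i x * ∑ j, pd j (pd j f) x) + s x * pd i f x) = ∫ x in K, ev (h i) x * f x

/-- The augmented local space `U_h^K`. -/
def augmentedSpace {n : ℕ} [NeZero n] (a : Fin n → Plane) (K : Set Plane) (k : ℕ) :
    Set (Fin 2 → Plane → ℝ) :=
  {v | (∀ i, IsH1 K (v i)) ∧
    (∃ g, HasBoundaryValues a K k v g) ∧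
    (∃ s, MemLp s 2 (volume.restrict K) ∧ ∃ h ∈ gPerp k, SolvesStokes K v s h) ∧
    ∃ p ∈ polyLE ((k : ℤ) - 1), weakDiv K v =ᵐ[volume.restrict K] ev p}

/-- `G_k^⊥ / G_{k-2}^⊥`: the elements of `G_k^⊥` that are `L²(K)`-orthogonal to `G_{k-2}^⊥`. -/
def gPerpOrth (K : Set Plane) (k : ℕ) : Set (Fin 2 → Poly) :=
  {g | g ∈ gPerp k ∧ ∀ h ∈ gPerp ((k : ℤ) - 2), ∫ x in K, ∑ i, ev (g i) x * ev (h i) x = 0}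

/-- The enhanced local virtual element space `V_h^K`. -/
def enhancedSpace {n : ℕ} [NeZero n] (a : Fin n → Plane) (K : Set Plane) (k : ℕ) :
    Set (Fin 2 → Plane → ℝ) :=
  {v | v ∈ augmentedSpace a K k ∧ ∃ π, IsEnergyProjection K k v π ∧
    ∀ g ∈ gPerpOrth K k, ∫ x in K, ∑ i, (v i x - ev (π i) x) * ev (g i) x = 0}

/-! ### Degrees of freedom -/

/-- Labels of the degrees of freedom: vertex values, edge point values, moments against the `d₃`
fields generating `G_{k-2}^⊥`, and divergence moments against `d₄` polynomials. -/
abbrev DofIndex (n k d₃ d₄ : ℕ) : Type :=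
  ((Fin n × Fin 2) ⊕ ((Fin n × Fin (k - 1)) × Fin 2)) ⊕ (Fin d₃ ⊕ Fin d₄)

/-- The vector of degrees of freedom of the field `v` with boundary values `g`. -/
noncomputable def dof {n k d₃ d₄ : ℕ} (a : Fin n → Plane) (K : Set Plane)
    (z : Fin n → Fin (k - 1) → Plane) (b₃ : Fin d₃ → Fin 2 → Poly) (b₄ : Fin d₄ → Poly)
    (v g : Fin 2 → Plane → ℝ) : DofIndex n k d₃ d₄ → ℝ
  | Sum.inl (Sum.inl (i, c)) => g c (a i)
  | Sum.inl (Sum.inr ((i, l), c)) => g c (z i l)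
  | Sum.inr (Sum.inl j) => ∫ x in K, ∑ c, v c x * ev (b₃ j c) x
  | Sum.inr (Sum.inr j) => ∫ x in K, weakDiv K v x * ev (b₄ j) x

/-- The subfield of `ℝ` generated by the known data: the coordinates of the vertices and of the
edge points, and the coefficients of the test polynomials used for the moments. Its elements are
the numbers that arise from these data by finitely many rational operations. -/
noncomputable def dataField {n k d₃ d₄ : ℕ} (a : Fin n → Plane)
    (z : Fin n → Fin (k - 1) → Plane) (b₃ : Fin d₃ → Fin 2 → Poly) (b₄ : Fin d₄ → Poly) :
    Subfield ℝ :=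
  Subfield.closure {r | (∃ i c, r = a i c) ∨ (∃ i l c, r = z i l c) ∨
    (∃ j c m, r = (b₃ j c).coeff m) ∨ (∃ j m, r = (b₄ j).coeff m)}

end VEM

/-!
The moments of a virtual element field `v` against all polynomial fields of degree at most `k`
are expressed through the degrees of freedom, with coefficients in the field `F` generated by the
data. This rests on Green's formula, the polynomial shape of the divergence and of the boundary
values, and the enhancement condition.

* Green's formula. A polygon that is star-shaped with respect to a ball is, up to the star centre,
  the disjoint union of the cones over its half-open edges, and all edges are passed in the same
  sense of rotation (`IsPolygon.diff_singleton_eq_iUnion_cone`, `IsPolygon.exists_orientation`).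
  The divergence theorem on each triangle, in the coordinates of the cone, gives the divergence
  theorem on `K`, because the contributions of the rays to the vertices telescope
  (`IsPolygon.exists_gaussGreen`). The definition of the trace by smooth approximation carries it
  over to `H¹` (`IsPolygon.exists_green`).

* Rationality. A finite linear system over `F` whose real solution is unique has a left inverse
  over `F`; so if its right-hand side depends `F`-linearly on the degrees of freedom, its solution
  does too (`mem_of_injective_system`). All unknown polynomials below are found in this way. For
  the boundary values the matrix is the Vandermonde matrix of the interpolation nodes. The other
  matrices have entries in `F` because integrals of monomials over `K` are boundary integrals
  (`IsPolygon.intPoly_monomial_mem`), and they are injective because the `L²(K)`-product is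
  definite on polynomials.

* Moments. The boundary values are interpolated from vertex and edge point values
  (`edge_integral_mem`). The divergence, a polynomial, is recovered from its moments, and Green's
  formula yields all moments of `v` against gradients (`grad_moment_mem`). Since
  `[P_m]² = ∇ P_{m+1} + x^⊥ P_{m-1}` (`moment_mem_of_grad_of_rot`), only the moments against
  `x^⊥ P_{m-1}` remain. For `m = k - 2` they are combinations of degrees of freedom, and the
  moments of degree at most `k - 2` and the boundary values determine the energy projection `π` of
  `v` (`hasCoeffsMem_energyProjection`). For `m = k`, the enhancement condition says that `v - π`
  is orthogonal to the part of `G_k^⊥` that is orthogonal to `G_{k-2}^⊥`, so that its moments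
  against `G_k^⊥` are determined by those against `G_{k-2}^⊥` (`mem_of_forall_orthogonal`,
  `moment_mem`).

The `L²`-projection is then obtained by inverting the Gram matrix of the monomials.
-/

namespace VEM

/-! ### Star-shaped polygons -/

/-- The determinant of two plane vectors. -/
def det2 (u v : Plane) : ℝ := u 0 * v 1 - u 1 * v 0

section Star

variable {K : Set Plane} {c : Plane} {r : ℝ}

/-- Star-shapedness with respect to a whole ball pushes closure points into `K` itself: the
direction of approach can be corrected by moving the star centre. -/
lemma add_smul_sub_mem_of_mem_closure (hr : 0 < r)
    (hstar : ∀ y ∈ Metric.ball c r, StarConvex ℝ y K) {x : Plane} (hx : x ∈ closure K) {s : ℝ}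
    (hs0 : 0 ≤ s) (hs1 : s < 1) : c + s • (x - c) ∈ K := by
  have hs : 0 < 1 - s := by linarith
  let φ : Plane → Plane := fun x' => c + (s / (1 - s)) • (x - x')
  have hφ : Continuous φ := by fun_prop
  have hx0 : x ∈ φ ⁻¹' Metric.ball c r := by simp [φ, hr]
  obtain ⟨x', hx'b, hx'⟩ := mem_closure_iff.1 hx _ (Metric.isOpen_ball.preimage hφ) hx0
  have := hstar _ hx'b hx' hs.le hs0 (by ring)
  convert this using 1
  ext i
  simp only [φ, PiLp.add_apply, PiLp.smul_apply, PiLp.sub_apply, smul_eq_mul]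
  field_simp
  ring

/-- Every ray from the star centre meets the frontier at most once. -/
lemma eq_one_of_ray_mem_frontier (hr : 0 < r) (hopen : IsOpen K)
    (hstar : ∀ y ∈ Metric.ball c r, StarConvex ℝ y K) {x : Plane} (hx : x ∈ frontier K) {τ : ℝ}
    (hτ : 0 < τ) (hx' : c + τ • (x - c) ∈ frontier K) : τ = 1 := by
  rw [hopen.frontier_eq] at hx hx'
  rcases lt_trichotomy τ 1 with h | h | h
  · exact absurd (add_smul_sub_mem_of_mem_closure hr hstar hx.1 hτ.le h) hx'.2
  · exact h
  · have := add_smul_sub_mem_of_mem_closure hr hstar hx'.1 (s := τ⁻¹) (by positivity)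
      (inv_lt_one_of_one_lt₀ h)
    rw [add_sub_cancel_left, smul_smul, inv_mul_cancel₀ hτ.ne', one_smul, add_sub_cancel] at this
    exact absurd this hx.2

end Star

section Polygon

variable {n : ℕ} [NeZero n] {a : Fin n → Plane} {K : Set Plane}

lemma lineMap_mem_edge (a : Fin n → Plane) (i : Fin n) {t : ℝ} (ht : t ∈ Set.Icc (0 : ℝ) 1) :
    AffineMap.lineMap (a i) (a (i + 1)) t ∈ edge a i := by
  rw [edge, segment_eq_image_lineMap]
  exact ⟨t, ht, rfl⟩

lemma IsPolygon.edge_subset (hK : IsPolygon a K) (i : Fin n) : edge a i ⊆ frontier K := by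
  rw [hK.frontier_eq]
  exact Set.subset_iUnion _ i

lemma IsPolygon.succ_ne (hK : IsPolygon a K) (i : Fin n) : i + 1 ≠ i := by
  have := hK.three_le
  obtain ⟨m, rfl⟩ : ∃ m, n = m + 2 := ⟨n - 2, by omega⟩
  simp

lemma IsPolygon.vertex_succ_ne (hK : IsPolygon a K) (i : Fin n) : a (i + 1) ≠ a i :=
  fun h => hK.succ_ne i (hK.injective h)

lemma lineMap_sub_apply (p q c : Plane) (t : ℝ) (j : Fin 2) :
    (AffineMap.lineMap p q t - c : Plane) j = p j - c j + t * (q j - p j) := by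
  simp [AffineMap.lineMap_apply]; ring

variable {c : Plane} {r : ℝ}

/-- A common point of two edges, each with its end point removed, determines the edge. -/
lemma IsPolygon.eq_of_lineMap_eq (hK : IsPolygon a K) {i j : Fin n} {t u : ℝ}
    (ht : t ∈ Set.Ico (0 : ℝ) 1) (hu : u ∈ Set.Ico (0 : ℝ) 1)
    (h : AffineMap.lineMap (a i) (a (i + 1)) t = (AffineMap.lineMap (a j) (a (j + 1)) u : Plane)) :
    i = j := by
  have key : ∀ (i j : Fin n) (t u : ℝ), t ∈ Set.Ico (0 : ℝ) 1 → u ∈ Set.Ico (0 : ℝ) 1 →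
      AffineMap.lineMap (a i) (a (i + 1)) t = (AffineMap.lineMap (a j) (a (j + 1)) u : Plane) →
      j ≠ i + 1 := by
    rintro i j t u ht hu h rfl
    have h1 := lineMap_mem_edge a i (Set.Ico_subset_Icc_self ht)
    have h2 := lineMap_mem_edge a (i + 1) (Set.Ico_subset_Icc_self hu)
    rw [← h] at h2
    have h3 : (AffineMap.lineMap (a i) (a (i + 1)) t : Plane) ∈ edge a i ∩ edge a (i + 1) :=
      ⟨h1, h2⟩
    rw [hK.adjacent i, Set.mem_singleton_iff] at h3
    rw [AffineMap.lineMap_eq_right_iff] at h3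
    rcases h3 with h3 | h3
    · exact hK.vertex_succ_ne i h3.symm
    · exact ht.2.ne h3
  by_contra hij
  have h1 := lineMap_mem_edge a i (Set.Ico_subset_Icc_self ht)
  have h2 := lineMap_mem_edge a j (Set.Ico_subset_Icc_self hu)
  exact Set.disjoint_left.1 (hK.disjoint i j (Ne.symm hij) (key i j t u ht hu h)
    (key j i u t hu ht h.symm)) h1 (h ▸ h2)

/-- Twice the signed area of the triangle spanned by the centre `c` and the `i`-th edge. -/
def edgeDet (a : Fin n → Plane) (c : Plane) (i : Fin n) : ℝ := det2 (a i - c) (a (i + 1) - a i)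

/-- No edge is seen from the star centre under a zero angle. -/
lemma IsPolygon.edgeDet_ne_zero (hK : IsPolygon a K) (hr : 0 < r) (hball : Metric.ball c r ⊆ K)
    (hstar : ∀ y ∈ Metric.ball c r, StarConvex ℝ y K) (i : Fin n) : edgeDet a c i ≠ 0 := by
  intro h0
  have hai : a i ∈ frontier K := hK.edge_subset i (left_mem_segment ℝ _ _)
  have hac : a i ≠ c := by
    rintro h
    have := hK.isOpen.frontier_eq ▸ hai
    exact this.2 (h ▸ hball (Metric.mem_ball_self hr))
  obtain ⟨l, hl⟩ : ∃ l : ℝ, a (i + 1) - a i = l • (a i - c) := by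
    unfold edgeDet det2 at h0
    by_cases h : (a i - c) 0 = 0
    · have h1 : (a i - c) 1 ≠ 0 := by
        intro h1
        apply hac
        rw [← sub_eq_zero]
        ext j; fin_cases j <;> assumption
      refine ⟨(a (i + 1) - a i) 1 / (a i - c) 1, ?_⟩
      ext j
      fin_cases j
      · simp only [h, zero_mul, zero_sub, neg_eq_zero, mul_eq_zero, h1, false_or] at h0
        simp only [Fin.zero_eta, PiLp.smul_apply, h, smul_eq_mul, mul_zero]; exact h0
      · simp only [Fin.mk_one, PiLp.smul_apply, smul_eq_mul]; field_simp
    · refine ⟨(a (i + 1) - a i) 0 / (a i - c) 0, ?_⟩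
      ext j
      fin_cases j
      · simp only [Fin.zero_eta, PiLp.smul_apply, smul_eq_mul]; field_simp
      · simp only [Fin.mk_one, PiLp.smul_apply, smul_eq_mul]; field_simp; linarith
  -- The edge lies on a line through `c`; its point with a small parameter `t` lies on the ray
  -- through `a i`, which forces it to be `a i` itself.
  set t : ℝ := 1 / (1 + |l|) with ht
  have hpos : 0 < 1 + |l| := by positivity
  have ht0 : 0 < t := by positivity
  have ht1 : t ≤ 1 := by rw [ht, div_le_one hpos]; linarith [abs_nonneg l]
  have hτ : 0 < 1 + t * l := by
    have h1 : t * |l| < 1 := by rw [ht]; field_simp; linarith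
    have : -(t * |l|) ≤ t * l := by nlinarith [neg_abs_le l]
    linarith
  have hmem := hK.edge_subset i (lineMap_mem_edge a i ⟨ht0.le, ht1⟩)
  have heq : (AffineMap.lineMap (a i) (a (i + 1)) t : Plane) = c + (1 + t * l) • (a i - c) := by
    rw [AffineMap.lineMap_apply, vsub_eq_sub, hl, vadd_eq_add]
    module
  rw [heq] at hmem
  have h1 := eq_one_of_ray_mem_frontier hr hK.isOpen hstar hai hτ hmem
  have hl0 : l = 0 := by
    have : t * l = 0 := by linarith
    exact (mul_eq_zero.1 this).resolve_left ht0.ne'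
  rw [hl0, zero_smul, sub_eq_zero] at hl
  exact hK.vertex_succ_ne i hl

/-- Consecutive edges are passed in the same sense of rotation: otherwise, near their common
vertex, a ray from the star centre would meet both of them. -/
lemma IsPolygon.edgeDet_mul_succ_pos (hK : IsPolygon a K) (hr : 0 < r)
    (hball : Metric.ball c r ⊆ K)
    (hstar : ∀ y ∈ Metric.ball c r, StarConvex ℝ y K) (i : Fin n) :
    0 < edgeDet a c i * edgeDet a c (i + 1) := by
  by_contra hneg
  have hD := hK.edgeDet_ne_zero hr hball hstar i
  have hD' := hK.edgeDet_ne_zero hr hball hstar (i + 1)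
  set D := edgeDet a c i with hDdef
  set D' := edgeDet a c (i + 1) with hDdef'
  have hy : D' / D < 0 := by
    rw [div_eq_mul_inv]
    have h1 : D * D' < 0 := lt_of_le_of_ne (not_lt.1 hneg) (mul_ne_zero hD hD')
    have : D' * D⁻¹ = (D * D') * (D⁻¹) ^ 2 := by field_simp
    rw [this]
    exact mul_neg_of_neg_of_pos h1 (by positivity)
  set y := D' / D with hydef
  set β := a (i + 1) - c with hβ
  set e := a (i + 1) - a i with he
  set e' := a (i + 1 + 1) - a (i + 1) with he'
  have hDe : D = β 0 * e 1 - β 1 * e 0 := by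
    simp only [hDdef, edgeDet, det2, hβ, he, PiLp.sub_apply]; ring
  have hDe' : D' = β 0 * e' 1 - β 1 * e' 0 := rfl
  -- Cramer's rule: `e'` in the basis `β, e`.
  set x := (e' 0 * e 1 - e' 1 * e 0) / D with hxdef
  have hcr : e' = x • β + y • e := by
    ext j
    fin_cases j <;> simp only [Fin.zero_eta, Fin.mk_one, PiLp.add_apply, PiLp.smul_apply,
      smul_eq_mul] <;> rw [hxdef, hydef] <;> field_simp <;> rw [hDe, hDe'] <;> ring
  -- If `y < 0`, the point `β + δ e'` of the second edge is, for small `δ`, a positive multiple of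
  -- the point `β - ε e` of the first one.
  set δ : ℝ := 1 / (1 + |x| + |y|) with hδ
  have hden : 0 < 1 + |x| + |y| := by positivity
  have hδ0 : 0 < δ := by positivity
  have hδ1 : δ ≤ 1 := by
    rw [hδ, div_le_one hden]; linarith [abs_nonneg x, abs_nonneg y]
  have hδs : δ + δ * |x| + δ * |y| = 1 := by rw [hδ]; field_simp
  have hδx : -(δ * |x|) ≤ δ * x := by nlinarith [neg_abs_le x]
  have hay : |y| = -y := abs_of_neg hy
  rw [hay] at hδs
  have hτ : 0 < 1 + δ * x := by nlinarith
  set ε := -(δ * y) / (1 + δ * x) with hε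
  have hε0 : 0 ≤ ε := div_nonneg (by nlinarith) hτ.le
  have hε1 : ε ≤ 1 := by rw [hε, div_le_one hτ]; nlinarith
  have hp : (AffineMap.lineMap (a i) (a (i + 1)) (1 - ε) : Plane) = c + (β - ε • e) := by
    rw [AffineMap.lineMap_apply, vsub_eq_sub, vadd_eq_add, hβ, he]; module
  have hp' : (AffineMap.lineMap (a (i + 1)) (a (i + 1 + 1)) δ : Plane) = c + (β + δ • e') := by
    rw [AffineMap.lineMap_apply, vsub_eq_sub, vadd_eq_add, hβ, he']; module
  have hray : β + δ • e' = (1 + δ * x) • (β - ε • e) := by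
    rw [hcr, smul_sub (1 + δ * x), smul_smul, hε, mul_div_cancel₀ _ hτ.ne']; module
  have hm := lineMap_mem_edge a i (t := 1 - ε) ⟨by linarith, by linarith⟩
  have hm' := lineMap_mem_edge a (i + 1) (t := δ) ⟨hδ0.le, hδ1⟩
  have hf := hK.edge_subset _ hm
  have hf' := hK.edge_subset _ hm'
  rw [hp'] at hf' hm'
  rw [hp] at hf hm
  have h1 : 1 + δ * x = 1 := by
    refine eq_one_of_ray_mem_frontier hr hK.isOpen hstar hf hτ ?_
    rw [add_sub_cancel_left, ← hray]; exact hf'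
  have heq : c + (β + δ • e') = c + (β - ε • e) := by rw [hray, h1, one_smul]
  have hb : c + (β + δ • e') ∈ edge a i ∩ edge a (i + 1) := ⟨heq ▸ hm, hm'⟩
  rw [hK.adjacent i, Set.mem_singleton_iff, ← hp', AffineMap.lineMap_eq_left_iff] at hb
  rcases hb with hb | hb
  · exact hK.vertex_succ_ne (i + 1) hb.symm
  · exact hδ0.ne' hb

/-- All edges are passed in the same sense of rotation around the star centre. -/
lemma IsPolygon.exists_orientation (hK : IsPolygon a K) (hr : 0 < r)
    (hball : Metric.ball c r ⊆ K)
    (hstar : ∀ y ∈ Metric.ball c r, StarConvex ℝ y K) :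
    ∃ σ : ℝ, (σ = 1 ∨ σ = -1) ∧ ∀ i, |edgeDet a c i| = σ * edgeDet a c i := by
  have key : ∀ m : ℕ, 0 < edgeDet a c 0 * edgeDet a c (Fin.ofNat n m) := by
    intro m
    induction m with
    | zero =>
      have := hK.edgeDet_ne_zero hr hball hstar 0
      simpa using mul_self_pos.2 this
    | succ m ih =>
      have h := hK.edgeDet_mul_succ_pos hr hball hstar (Fin.ofNat n m)
      have hs : Fin.ofNat n m + 1 = Fin.ofNat n (m + 1) := by
        ext; simp [Fin.val_add]
      rw [hs] at h
      have hD := hK.edgeDet_ne_zero hr hball hstar (Fin.ofNat n m)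
      have h3 := mul_pos ih h
      have : 0 < (edgeDet a c 0 * edgeDet a c (Fin.ofNat n (m + 1))) *
          (edgeDet a c (Fin.ofNat n m)) ^ 2 := by linarith
      exact (pos_iff_pos_of_mul_pos this).2 (by positivity)
  have key' : ∀ i, 0 < edgeDet a c 0 * edgeDet a c i := by
    intro i
    have := key i
    rwa [show Fin.ofNat n i = i by ext; simp] at this
  rcases lt_or_gt_of_ne (hK.edgeDet_ne_zero hr hball hstar 0) with h | h
  · refine ⟨-1, Or.inr rfl, fun i => ?_⟩
    rw [abs_of_neg (neg_of_mul_pos_right (key' i) h.le)]; ring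
  · refine ⟨1, Or.inl rfl, fun i => ?_⟩
    rw [abs_of_pos (pos_of_mul_pos_right (key' i) h.le), one_mul]

/-- Barycentric-polar coordinates on the cone over the `i`-th edge with apex `c`. -/
noncomputable def cone (a : Fin n → Plane) (c : Plane) (i : Fin n) (p : ℝ × ℝ) : Plane :=
  c + p.1 • (AffineMap.lineMap (a i) (a (i + 1)) p.2 - c)

lemma cone_apply (a : Fin n → Plane) (c : Plane) (i : Fin n) (p : ℝ × ℝ) (j : Fin 2) :
    cone a c i p j = c j + p.1 * (a i j - c j + p.2 * (a (i + 1) j - a i j)) := by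
  rw [cone, PiLp.add_apply, PiLp.smul_apply, lineMap_sub_apply, smul_eq_mul]

/-- Cones over half-open edges meet only if the edges and the points agree. -/
lemma IsPolygon.cone_eq_cone (hK : IsPolygon a K) (hr : 0 < r)
    (hstar : ∀ y ∈ Metric.ball c r, StarConvex ℝ y K) {i j : Fin n} {p q : ℝ × ℝ}
    (hp : p ∈ Set.Ioo (0 : ℝ) 1 ×ˢ Set.Ico (0 : ℝ) 1)
    (hq : q ∈ Set.Ioo (0 : ℝ) 1 ×ˢ Set.Ico (0 : ℝ) 1) (h : cone a c i p = cone a c j q) :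
    i = j ∧ p = q := by
  obtain ⟨s, t⟩ := p
  obtain ⟨s', t'⟩ := q
  obtain ⟨hs, ht⟩ := hp
  obtain ⟨hs', ht'⟩ := hq
  simp only [cone, add_right_inj] at h hs ht hs' ht'
  have hx := hK.edge_subset i (lineMap_mem_edge a i (Set.Ico_subset_Icc_self ht))
  have hx' := hK.edge_subset j (lineMap_mem_edge a j (Set.Ico_subset_Icc_self ht'))
  have hray : (AffineMap.lineMap (a j) (a (j + 1)) t' : Plane) =
      c + (s / s') • (AffineMap.lineMap (a i) (a (i + 1)) t - c) := by
    rw [div_eq_inv_mul, ← smul_smul, h, smul_smul, inv_mul_cancel₀ hs'.1.ne', one_smul,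
      add_sub_cancel]
  have h1 : s / s' = 1 := eq_one_of_ray_mem_frontier hr hK.isOpen hstar hx
    (div_pos hs.1 hs'.1) (hray ▸ hx')
  rw [h1, one_smul, add_sub_cancel] at hray
  obtain rfl := hK.eq_of_lineMap_eq ht' ht hray
  refine ⟨rfl, Prod.ext ?_ ?_⟩
  · exact (div_eq_one_iff_eq hs'.1.ne').1 h1
  · exact (AffineMap.lineMap_injective ℝ (hK.vertex_succ_ne j).symm hray).symm

/-- Up to the star centre, `K` is the union of the cones over its half-open edges. -/
lemma IsPolygon.diff_singleton_eq_iUnion_cone (hK : IsPolygon a K) (hr : 0 < r)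
    (hball : Metric.ball c r ⊆ K) (hstar : ∀ y ∈ Metric.ball c r, StarConvex ℝ y K) :
    K \ {c} = ⋃ i, cone a c i '' (Set.Ioo (0 : ℝ) 1 ×ˢ Set.Ico (0 : ℝ) 1) := by
  have hcK : c ∈ K := hball (Metric.mem_ball_self hr)
  apply Set.Subset.antisymm
  · rintro x ⟨hxK, hxc⟩
    rw [Set.mem_singleton_iff] at hxc
    -- The ray from `c` through `x` leaves the bounded set `K`, hence meets its frontier beyond `x`.
    obtain ⟨τ, hτ, hτf⟩ : ∃ τ : ℝ, 1 < τ ∧ c + τ • (x - c) ∈ frontier K := by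
      let ρ : ℝ → Plane := fun τ => c + τ • (x - c)
      have hρ : Continuous ρ := by fun_prop
      obtain ⟨R, hR⟩ := hK.isBounded.subset_closedBall c
      have hpos : 0 < ‖x - c‖ := norm_pos_iff.2 (sub_ne_zero.2 hxc)
      have hfar : ∃ T : ℝ, 1 ≤ T ∧ ρ T ∉ K := by
        refine ⟨max 1 ((R + 1) / ‖x - c‖), le_max_left _ _, fun hmem => ?_⟩
        have := hR hmem
        simp only [ρ, Metric.mem_closedBall, dist_self_add_left, norm_smul,
          Real.norm_eq_abs] at this
        rw [abs_of_nonneg (le_trans zero_le_one (le_max_left _ _))] at this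
        have h2 : (R + 1) / ‖x - c‖ * ‖x - c‖ ≤ max 1 ((R + 1) / ‖x - c‖) * ‖x - c‖ :=
          mul_le_mul_of_nonneg_right (le_max_right _ _) hpos.le
        rw [div_mul_cancel₀ _ hpos.ne'] at h2
        linarith
      obtain ⟨T, hT, hTK⟩ := hfar
      have hpre : IsPreconnected (ρ '' Set.Icc 1 T) := isPreconnected_Icc.image _ hρ.continuousOn
      have h1 : (ρ '' Set.Icc 1 T ∩ K).Nonempty :=
        ⟨x, ⟨1, ⟨le_rfl, hT⟩, by simp [ρ]⟩, hxK⟩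
      obtain ⟨_, ⟨τ, hτ, rfl⟩, hf⟩ : (ρ '' Set.Icc 1 T ∩ frontier K).Nonempty := by
        by_contra hempty
        rw [Set.not_nonempty_iff_eq_empty, ← Set.disjoint_iff_inter_eq_empty,
          Set.disjoint_left] at hempty
        have hcov : ∀ y ∈ ρ '' Set.Icc 1 T, y ∉ K → y ∈ (closure K)ᶜ := fun y hy hyK hyc =>
          hempty hy (by rw [hK.isOpen.frontier_eq]; exact ⟨hyc, hyK⟩)
        obtain ⟨y, -, hyK, hyc⟩ := hpre K (closure K)ᶜ hK.isOpen isClosed_closure.isOpen_compl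
          (fun y hy => or_iff_not_imp_left.2 (hcov y hy)) h1
          ⟨ρ T, ⟨T, ⟨hT, le_rfl⟩, rfl⟩, hcov _ ⟨T, ⟨hT, le_rfl⟩, rfl⟩ hTK⟩
        exact hyc (subset_closure hyK)
      refine ⟨τ, lt_of_le_of_ne hτ.1 ?_, hf⟩
      rintro rfl
      rw [hK.isOpen.frontier_eq] at hf
      exact hf.2 (by simpa [ρ] using hxK)
    have hmem : ∃ i, ∃ t ∈ Set.Ico (0 : ℝ) 1,
        (AffineMap.lineMap (a i) (a (i + 1)) t : Plane) = c + τ • (x - c) := by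
      rw [hK.frontier_eq, Set.mem_iUnion] at hτf
      obtain ⟨i, hi⟩ := hτf
      rw [edge, segment_eq_image_lineMap] at hi
      obtain ⟨t, ht, hti⟩ := hi
      rcases ht.2.lt_or_eq with h | rfl
      · exact ⟨i, t, ⟨ht.1, h⟩, hti⟩
      · refine ⟨i + 1, 0, ⟨le_rfl, one_pos⟩, ?_⟩
        rw [AffineMap.lineMap_apply_one] at hti
        rw [AffineMap.lineMap_apply_zero, hti]
    obtain ⟨i, t, ht, hti⟩ := hmem
    refine Set.mem_iUnion.2 ⟨i, (τ⁻¹, t), ⟨⟨by positivity, inv_lt_one_of_one_lt₀ hτ⟩, ht⟩, ?_⟩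
    simp only [cone]
    rw [hti, add_sub_cancel_left, smul_smul, inv_mul_cancel₀ (by positivity), one_smul,
      add_sub_cancel]
  · refine Set.iUnion_subset fun i => ?_
    rintro _ ⟨⟨s, t⟩, ⟨hs, ht⟩, rfl⟩
    have hx := hK.edge_subset i (lineMap_mem_edge a i (Set.Ico_subset_Icc_self ht))
    refine ⟨add_smul_sub_mem_of_mem_closure hr hstar (frontier_subset_closure hx) hs.1.le hs.2, ?_⟩
    rw [Set.mem_singleton_iff, cone, add_eq_left, smul_eq_zero, not_or, sub_eq_zero]
    refine ⟨hs.1.ne', fun h => ?_⟩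
    simp only at h
    rw [hK.isOpen.frontier_eq, h] at hx
    exact hx.2 hcK

end Polygon

/-! ### The divergence theorem on a star-shaped polygon -/

section GaussGreen

variable {n : ℕ} [NeZero n] {a : Fin n → Plane} {K : Set Plane} {c : Plane} {r : ℝ}

/-- The plane as a product of two lines. -/
def prodEquivPlane : ℝ × ℝ ≃ᵐ Plane :=
  (MeasurableEquiv.finTwoArrow (α := ℝ)).symm.trans (MeasurableEquiv.toLp 2 (Fin 2 → ℝ))

lemma measurePreserving_prodEquivPlane :
    MeasurePreserving prodEquivPlane volume volume :=
  ((volume_preserving_finTwoArrow ℝ).symm _).trans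
    ((EuclideanSpace.volume_preserving_symm_measurableEquiv_toLp (Fin 2)).symm _)

/-- The cone parametrization written in coordinates. -/
noncomputable def coneCoord (a : Fin n → Plane) (c : Plane) (i : Fin n) (p : ℝ × ℝ) : ℝ × ℝ :=
  (cone a c i p 0, cone a c i p 1)

lemma prodEquivPlane_coneCoord (a : Fin n → Plane) (c : Plane) (i : Fin n) (p : ℝ × ℝ) :
    prodEquivPlane (coneCoord a c i p) = cone a c i p := by
  ext j; fin_cases j <;> rfl

/-- The derivative of `coneCoord`. -/
noncomputable def fderivConeCoord (a : Fin n → Plane) (c : Plane) (i : Fin n) (p : ℝ × ℝ) :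
    ℝ × ℝ →L[ℝ] ℝ × ℝ :=
  (Matrix.toLin (.finTwoProd ℝ) (.finTwoProd ℝ)
    !![a i 0 - c 0 + p.2 * (a (i + 1) 0 - a i 0), p.1 * (a (i + 1) 0 - a i 0);
      a i 1 - c 1 + p.2 * (a (i + 1) 1 - a i 1),
        p.1 * (a (i + 1) 1 - a i 1)]).toContinuousLinearMap

lemma hasFDerivAt_cone_apply (a : Fin n → Plane) (c : Plane) (i : Fin n) (p : ℝ × ℝ)
    (j : Fin 2) : HasFDerivAt (fun p => cone a c i p j)
      ((a i j - c j + p.2 * (a (i + 1) j - a i j)) • ContinuousLinearMap.fst ℝ ℝ ℝ +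
        (p.1 * (a (i + 1) j - a i j)) • ContinuousLinearMap.snd ℝ ℝ ℝ) p := by
  simp_rw [cone_apply]
  have h2 : HasFDerivAt (fun p : ℝ × ℝ => a i j - c j + p.2 * (a (i + 1) j - a i j))
      ((a (i + 1) j - a i j) • ContinuousLinearMap.snd ℝ ℝ ℝ) p :=
    (hasFDerivAt_snd.mul_const _).const_add _
  refine ((hasFDerivAt_fst.mul h2).const_add (c j)).congr_fderiv ?_
  rw [smul_smul, add_comm]

lemma hasFDerivAt_coneCoord (a : Fin n → Plane) (c : Plane) (i : Fin n) (p : ℝ × ℝ) :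
    HasFDerivAt (coneCoord a c i) (fderivConeCoord a c i p) p := by
  unfold fderivConeCoord
  rw [Matrix.toLin_finTwoProd_toContinuousLinearMap]
  exact (hasFDerivAt_cone_apply a c i p 0).prodMk (hasFDerivAt_cone_apply a c i p 1)

lemma det_fderivConeCoord (a : Fin n → Plane) (c : Plane) (i : Fin n) (p : ℝ × ℝ) :
    (fderivConeCoord a c i p).det = p.1 * edgeDet a c i := by
  unfold fderivConeCoord edgeDet det2
  simp only [LinearMap.det_toContinuousLinearMap, LinearMap.det_toLin, Matrix.det_fin_two_of,
    PiLp.sub_apply]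
  ring

lemma continuous_cone (a : Fin n → Plane) (c : Plane) (i : Fin n) : Continuous (cone a c i) := by
  have : cone a c i = fun p => c + p.1 • (AffineMap.lineMap (a i) (a (i + 1)) p.2 - c) := rfl
  rw [this]
  have h2 : Continuous fun p : ℝ × ℝ => (AffineMap.lineMap (a i) (a (i + 1)) p.2 : Plane) :=
    AffineMap.lineMap_continuous.comp continuous_snd
  fun_prop

lemma integrableOn_of_continuous_of_isBounded {h : Plane → ℝ} (hh : Continuous h)
    (hK : Bornology.IsBounded K) : IntegrableOn h K :=
  (hh.continuousOn.integrableOn_compact hK.isCompact_closure).mono_set subset_closure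

/-- Integration over `K` in the coordinates of the cones over the edges. -/
lemma IsPolygon.integral_eq_sum_cone (hK : IsPolygon a K) (hr : 0 < r)
    (hball : Metric.ball c r ⊆ K) (hstar : ∀ y ∈ Metric.ball c r, StarConvex ℝ y K)
    {h : Plane → ℝ} (hh : Continuous h) :
    ∫ x in K, h x = ∑ i, |edgeDet a c i| *
      ∫ s in (0 : ℝ)..1, ∫ t in (0 : ℝ)..1, s * h (cone a c i (s, t)) := by
  set Q : Set (ℝ × ℝ) := Set.Ioo (0 : ℝ) 1 ×ˢ Set.Ico (0 : ℝ) 1 with hQ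
  have hQm : MeasurableSet Q := measurableSet_Ioo.prod measurableSet_Ico
  have hinj : ∀ i, Set.InjOn (coneCoord a c i) Q := fun i p hp q hq hpq =>
    (hK.cone_eq_cone hr hstar hp hq (by
      rw [← prodEquivPlane_coneCoord, ← prodEquivPlane_coneCoord, hpq])).2
  have hae : (K \ {c} : Set Plane) =ᵐ[volume] K := by
    refine sdiff_null_ae_eq_self ?_
    simp
  have hpre : prodEquivPlane ⁻¹' (K \ {c}) = ⋃ i, coneCoord a c i '' Q := by
    rw [hK.diff_singleton_eq_iUnion_cone hr hball hstar]
    ext p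
    simp only [Set.preimage_iUnion, Set.mem_iUnion, Set.mem_preimage, Set.mem_image]
    refine exists_congr fun i => exists_congr fun q => and_congr_right fun _ => ?_
    rw [← prodEquivPlane_coneCoord, prodEquivPlane.injective.eq_iff]
  have hmeas : ∀ i, MeasurableSet (coneCoord a c i '' Q) := fun i =>
    measurable_image_of_fderivWithin hQm
      (fun p _ => (hasFDerivAt_coneCoord a c i p).hasFDerivWithinAt) (hinj i)
  have hdisj : Pairwise (Function.onFun Disjoint fun i => coneCoord a c i '' Q) := by
    intro i j hij
    rw [Function.onFun, Set.disjoint_left]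
    rintro _ ⟨p, hp, rfl⟩ ⟨q, hq, hpq⟩
    exact hij (hK.cone_eq_cone hr hstar hp hq (by
      rw [← prodEquivPlane_coneCoord, ← prodEquivPlane_coneCoord, hpq])).1
  have hint : IntegrableOn h (K \ {c}) :=
    (integrableOn_of_continuous_of_isBounded hh hK.isBounded).mono_set Set.sdiff_subset
  have hint' : IntegrableOn (h ∘ prodEquivPlane) (⋃ i, coneCoord a c i '' Q) := by
    rw [← hpre]
    exact (measurePreserving_prodEquivPlane.integrableOn_comp_preimage
      prodEquivPlane.measurableEmbedding).2 hint
  rw [← setIntegral_congr_set hae, ← measurePreserving_prodEquivPlane.setIntegral_preimage_emb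
    prodEquivPlane.measurableEmbedding, hpre]
  change ∫ p in _, (h ∘ prodEquivPlane) p = _
  rw [integral_iUnion_fintype hmeas hdisj fun i => hint'.mono_set
      (Set.subset_iUnion (fun i => coneCoord a c i '' Q) i)]
  refine Finset.sum_congr rfl fun i _ => ?_
  rw [integral_image_eq_integral_abs_det_fderiv_smul volume hQm
    (fun p _ => (hasFDerivAt_coneCoord a c i p).hasFDerivWithinAt) (hinj i)]
  have h1 : ∫ p in Q, |(fderivConeCoord a c i p).det| •
      (h ∘ prodEquivPlane) (coneCoord a c i p) =
      ∫ p in Q, |edgeDet a c i| * (p.1 * h (cone a c i p)) := by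
    refine setIntegral_congr_fun hQm fun p hp => ?_
    simp only [Function.comp_apply, det_fderivConeCoord, prodEquivPlane_coneCoord, abs_mul,
      abs_of_pos hp.1.1, smul_eq_mul]
    ring
  have hcont : Continuous fun p : ℝ × ℝ => p.1 * h (cone a c i p) :=
    continuous_fst.mul (hh.comp (continuous_cone a c i))
  have hintQ : IntegrableOn (fun p : ℝ × ℝ => p.1 * h (cone a c i p)) Q :=
    (hcont.continuousOn.integrableOn_compact
      ((isCompact_Icc (a := (0 : ℝ)) (b := 1)).prod
        (isCompact_Icc (a := (0 : ℝ)) (b := 1)))).mono_set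
      (Set.prod_mono Set.Ioo_subset_Icc_self Set.Ico_subset_Icc_self)
  rw [h1, integral_const_mul]
  congr 1
  rw [Measure.volume_eq_prod, setIntegral_prod _ (by rw [← Measure.volume_eq_prod]; exact hintQ),
    intervalIntegral.integral_of_le zero_le_one, integral_Ioc_eq_integral_Ioo]
  refine setIntegral_congr_fun measurableSet_Ioo fun s _ => ?_
  simp only
  rw [intervalIntegral.integral_of_le zero_le_one, integral_Ioc_eq_integral_Ioo,
    integral_Ico_eq_integral_Ioo]

lemma lineMap_apply_coord (p q : Plane) (t : ℝ) (j : Fin 2) :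
    (AffineMap.lineMap p q t : Plane) j = p j + t * (q j - p j) := by
  simpa using lineMap_sub_apply p q 0 t j

lemma fderiv_apply_eq_pd (f : Plane → ℝ) (x w : Plane) :
    fderiv ℝ f x w = w 0 * pd 0 f x + w 1 * pd 1 f x := by
  have hw : w = w 0 • EuclideanSpace.single 0 (1 : ℝ) + w 1 • EuclideanSpace.single 1 (1 : ℝ) := by
    ext j; fin_cases j <;> simp
  conv_lhs => rw [hw]
  rw [map_add, map_smul, map_smul]
  rfl

/-- The rotated vector of the `i`-th edge, that is its length times its unit normal, up to
orientation. -/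
def edgeNormal (a : Fin n → Plane) (i : Fin n) : Fin 2 → ℝ :=
  ![a (i + 1) 1 - a i 1, -(a (i + 1) 0 - a i 0)]

lemma hasFDerivAt_cone (a : Fin n → Plane) (c : Plane) (i : Fin n) (p : ℝ × ℝ) :
    HasFDerivAt (cone a c i)
      ((ContinuousLinearMap.fst ℝ ℝ ℝ).smulRight
          (AffineMap.lineMap (a i) (a (i + 1)) p.2 - c : Plane) +
        (ContinuousLinearMap.snd ℝ ℝ ℝ).smulRight (p.1 • (a (i + 1) - a i))) p := by
  rw [← hasFDerivWithinAt_univ, hasFDerivWithinAt_euclidean]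
  intro j
  rw [hasFDerivWithinAt_univ]
  refine (hasFDerivAt_cone_apply a c i p j).congr_fderiv ?_
  ext <;> simp [lineMap_apply_coord]; ring

lemma continuous_pd {f : Plane → ℝ} (hf : ContDiff ℝ ∞ f) (j : Fin 2) : Continuous (pd j f) :=
  (hf.continuous_fderiv (by simp)).clm_apply continuous_const

/-- The divergence theorem on the triangle over the `i`-th edge, with the two sides through the
star centre written as integrals over rays. -/
lemma triangle_divergence (a : Fin n → Plane) (c : Plane) (i : Fin n) {f : Plane → ℝ}
    (hf : ContDiff ℝ ∞ f) (j : Fin 2) :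
    edgeDet a c i * ∫ s in (0 : ℝ)..1, ∫ t in (0 : ℝ)..1, s * pd j f (cone a c i (s, t)) =
      edgeNormal a i j * (∫ t in (0 : ℝ)..1, f (AffineMap.lineMap (a i) (a (i + 1)) t)) +
      ((![-(a (i + 1) 1 - c 1), a (i + 1) 0 - c 0] j *
          ∫ s in (0 : ℝ)..1, f (c + s • (a (i + 1) - c))) -
        ![-(a i 1 - c 1), a i 0 - c 0] j * ∫ s in (0 : ℝ)..1, f (c + s • (a i - c))) := by
  -- `N` is the rotated edge vector and `M t` the rotated ray through the edge point with
  -- parameter `t`; the integrand is the divergence of `(s N f, M f)` in the variables `(s, t)`.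
  set N := edgeNormal a i j with hN
  set m : ℝ := ![-(a i 1 - c 1), a i 0 - c 0] j with hm
  have hm' : ![-(a (i + 1) 1 - c 1), a (i + 1) 0 - c 0] j = m - N := by
    rw [hm, hN, edgeNormal]; fin_cases j <;> simp
  let G : ℝ × ℝ → ℝ := fun p => f (cone a c i p)
  let G' : ℝ × ℝ → ℝ × ℝ →L[ℝ] ℝ := fun p => (fderiv ℝ f (cone a c i p)).comp
    ((ContinuousLinearMap.fst ℝ ℝ ℝ).smulRight
          (AffineMap.lineMap (a i) (a (i + 1)) p.2 - c : Plane) +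
        (ContinuousLinearMap.snd ℝ ℝ ℝ).smulRight (p.1 • (a (i + 1) - a i)))
  have hG : ∀ p, HasFDerivAt G (G' p) p := fun p =>
    ((hf.differentiable (by simp)) _).hasFDerivAt.comp p (hasFDerivAt_cone a c i p)
  have hGc : Continuous G := hf.continuous.comp (continuous_cone a c i)
  let A' : ℝ × ℝ → ℝ × ℝ →L[ℝ] ℝ := fun p =>
    (p.1 * N) • G' p + G p • (N • ContinuousLinearMap.fst ℝ ℝ ℝ)
  let B' : ℝ × ℝ → ℝ × ℝ →L[ℝ] ℝ := fun p =>
    (m - p.2 * N) • G' p + G p • (-N • ContinuousLinearMap.snd ℝ ℝ ℝ)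
  have hkey : ∀ p : ℝ × ℝ, A' p (1, 0) + B' p (0, 1) =
      edgeDet a c i * (p.1 * pd j f (cone a c i p)) := by
    intro p
    simp only [A', B', G', add_apply, smul_apply,
      ContinuousLinearMap.comp_apply, ContinuousLinearMap.smulRight_apply,
      ContinuousLinearMap.coe_fst', ContinuousLinearMap.coe_snd', one_smul, zero_smul, add_zero,
      zero_add, fderiv_apply_eq_pd, lineMap_apply_coord, PiLp.smul_apply, PiLp.sub_apply,
      smul_eq_mul, hN, hm, edgeNormal, edgeDet, det2]
    fin_cases j <;> simp <;> ring
  have hcont : Continuous fun p : ℝ × ℝ => edgeDet a c i * (p.1 * pd j f (cone a c i p)) :=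
    continuous_const.mul (continuous_fst.mul ((continuous_pd hf j).comp (continuous_cone a c i)))
  have hdiv := integral2_divergence_prod_of_hasFDerivAt
    (fun p => (p.1 * N) * G p) (fun p => (m - p.2 * N) * G p)
    A' B' 0 0 1 1
    (by fun_prop) (by fun_prop)
    (fun p _ => (hasFDerivAt_fst.mul_const N).mul (hG p))
    (fun p _ => by
      refine (((hasFDerivAt_snd (𝕜 := ℝ) (p := p)).mul_const N).const_sub m).mul (hG p)
        |>.congr_fderiv ?_
      ext <;> simp [B'])
    (by
      simp_rw [hkey]
      exact hcont.continuousOn.integrableOn_compact (isCompact_uIcc.prod isCompact_uIcc))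
  simp_rw [hkey] at hdiv
  simp_rw [intervalIntegral.integral_const_mul] at hdiv ⊢
  have e1 : ∀ t : ℝ, G (1, t) = f (AffineMap.lineMap (a i) (a (i + 1)) t) := fun t => by
    simp [G, cone]
  have e2 : ∀ s : ℝ, G (s, 1) = f (c + s • (a (i + 1) - c)) := fun s => by simp [G, cone]
  have e3 : ∀ s : ℝ, G (s, 0) = f (c + s • (a i - c)) := fun s => by simp [G, cone]
  simp only [e1, e2, e3, one_mul, zero_mul, sub_zero] at hdiv
  rw [hdiv, hm']
  ring

/-- The divergence theorem on a star-shaped polygon, one partial derivative at a time. The sign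
`σ` is the orientation of the vertex list. -/
theorem IsPolygon.exists_gaussGreen (hK : IsPolygon a K) (hstar : StarShapedBall K) :
    ∃ σ : ℝ, (σ = 1 ∨ σ = -1) ∧ ∀ f : Plane → ℝ, ContDiff ℝ ∞ f → ∀ j,
      ∫ x in K, pd j f x = ∑ i, σ * edgeNormal a i j *
        ∫ t in (0 : ℝ)..1, f (AffineMap.lineMap (a i) (a (i + 1)) t) := by
  obtain ⟨c, r, hr, hball, hst⟩ := hstar
  obtain ⟨σ, hσ, hD⟩ := hK.exists_orientation hr hball hst
  refine ⟨σ, hσ, fun f hf j => ?_⟩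
  rw [hK.integral_eq_sum_cone hr hball hst (continuous_pd hf j)]
  simp_rw [hD, mul_assoc, triangle_divergence a c _ hf j, mul_add, ← mul_assoc]
  rw [Finset.sum_add_distrib, add_eq_left, ← Finset.mul_sum, Finset.sum_sub_distrib]
  -- The contributions of the rays telescope along the cyclic vertex list.
  exact mul_eq_zero_of_right σ (sub_eq_zero.2 (Equiv.sum_comp (Equiv.addRight (1 : Fin n)) fun i =>
    ![-(a i 1 - c 1), a i 0 - c 0] j * ∫ s in (0 : ℝ)..1, f (c + s • (a i - c))))

end GaussGreen

/-! ### Polynomials as functions on the plane -/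

section Eval

@[simp] lemma ev_zero (x : Plane) : ev 0 x = 0 := map_zero _

@[simp] lemma ev_one (x : Plane) : ev 1 x = 1 := map_one _

@[simp] lemma ev_add (p q : Poly) (x : Plane) : ev (p + q) x = ev p x + ev q x := map_add _ _ _

@[simp] lemma ev_mul (p q : Poly) (x : Plane) : ev (p * q) x = ev p x * ev q x := map_mul _ _ _

@[simp] lemma ev_smul (r : ℝ) (p : Poly) (x : Plane) : ev (r • p) x = r * ev p x := by
  simp [ev, MvPolynomial.smul_eval]

lemma hasFDerivAt_ev (p : Poly) (x : Plane) : HasFDerivAt (ev p)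
    (∑ j, ev (MvPolynomial.pderiv j p) x • (EuclideanSpace.proj j : Plane →L[ℝ] ℝ)) x := by
  induction p using MvPolynomial.induction_on with
  | C r =>
    have : ev (MvPolynomial.C r) = fun _ => r := by ext; simp [ev]
    rw [this]
    simpa using hasFDerivAt_const r x
  | add p q hp hq =>
    have : ev (p + q) = ev p + ev q := by ext; simp
    rw [this]
    refine (hp.add hq).congr_fderiv ?_
    simp [add_smul, Finset.sum_add_distrib]
  | mul_X p i hp =>
    have : ev (p * MvPolynomial.X i) = fun x => ev p x * x i := by ext; simp [ev]
    rw [this]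
    refine (hp.mul (EuclideanSpace.proj i : Plane →L[ℝ] ℝ).hasFDerivAt).congr_fderiv ?_
    ext v
    fin_cases i <;> simp [Derivation.leibniz, MvPolynomial.pderiv_X, ev] <;> ring

lemma contDiff_ev (p : Poly) : ContDiff ℝ ∞ (ev p) :=
  (AnalyticOnNhd.eval_continuousLinearMap' (𝕜 := ℝ)
    (fun i => (EuclideanSpace.proj i : Plane →L[ℝ] ℝ)) p).contDiff

lemma continuous_ev (p : Poly) : Continuous (ev p) := (contDiff_ev p).continuous

lemma pd_ev (j : Fin 2) (p : Poly) (x : Plane) :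
    pd j (ev p) x = ev (MvPolynomial.pderiv j p) x := by
  rw [pd, (hasFDerivAt_ev p x).fderiv]
  fin_cases j <;> simp

/-- A polynomial that vanishes on a nonempty open set is zero. -/
lemma eq_zero_of_ev_eq_zero {K : Set Plane} (hK : IsOpen K) (hne : K.Nonempty) {p : Poly}
    (h : ∀ x ∈ K, ev p x = 0) : p = 0 := by
  obtain ⟨c, hc⟩ := hne
  have hcont : ContinuousAt (fun y : Fin 2 → ℝ => (WithLp.toLp 2 y : Plane)) c := by fun_prop
  have hnhds : {y : Fin 2 → ℝ | (WithLp.toLp 2 y : Plane) ∈ K} ∈ 𝓝 (c : Fin 2 → ℝ) :=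
    hcont (hK.mem_nhds hc)
  obtain ⟨ε, hε, hball⟩ := Metric.mem_nhds_iff.1 hnhds
  refine MvPolynomial.funext_set (fun i => Set.Ioo (c i) (c i + ε))
    (fun i => Set.Ioo_infinite (by linarith)) fun y hy => ?_
  rw [map_zero]
  refine h (WithLp.toLp 2 y) (hball ?_)
  rw [Metric.mem_ball, dist_pi_lt_iff hε]
  intro i
  have := hy i (Set.mem_univ i)
  rw [Real.dist_eq, abs_lt]
  constructor <;> linarith [this.1, this.2]

/-- The `L²(K)`-product of polynomials is definite. -/
lemma eq_zero_of_integral_mul_self_eq_zero {K : Set Plane} (hK : IsOpen K) (hne : K.Nonempty)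
    (hb : Bornology.IsBounded K) {p : Poly} (h : ∫ x in K, ev (p * p) x = 0) : p = 0 := by
  refine eq_zero_of_ev_eq_zero hK hne ?_
  have h1 := (setIntegral_eq_zero_iff_of_nonneg_ae
    (Eventually.of_forall fun x => by simpa using mul_self_nonneg (ev p x))
    (integrableOn_of_continuous_of_isBounded (continuous_ev (p * p)) hb)).1 h
  have h2 := Measure.eqOn_open_of_ae_eq h1 hK (continuous_ev _).continuousOn
    continuous_const.continuousOn
  intro x hx
  have := h2 hx
  simpa using this

end Eval

/-! ### Green's formula for functions with a trace -/

section Green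

lemma memLp_of_continuous_of_isBounded {h : Plane → ℝ} (hh : Continuous h) {K : Set Plane}
    (hK : Bornology.IsBounded K) (p : ENNReal) : MemLp h p (volume.restrict K) := by
  obtain ⟨C, hC⟩ := hK.isCompact_closure.exists_bound_of_continuousOn hh.continuousOn
  have : IsFiniteMeasure (volume.restrict K) :=
    ⟨by rw [Measure.restrict_apply_univ]; exact hK.measure_lt_top⟩
  have : IsFiniteMeasure (volume.restrict (closure K)) :=
    ⟨by rw [Measure.restrict_apply_univ]; exact hK.isCompact_closure.measure_lt_top⟩
  have h1 : MemLp h p (volume.restrict (closure K)) :=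
    MemLp.of_bound hh.aestronglyMeasurable C
      ((ae_restrict_iff' isClosed_closure.measurableSet).2 (Eventually.of_forall hC))
  exact h1.mono_measure (Measure.restrict_mono subset_closure le_rfl)

/-- Convergence in `L²` is preserved by testing against a fixed `L²` function. -/
lemma tendsto_integral_mul_of_tendsto_eLpNorm {α : Type*} [MeasurableSpace α] {μ : Measure α}
    {u h : α → ℝ} {f : ℕ → α → ℝ} (hu : MemLp u 2 μ) (hf : ∀ N, MemLp (f N) 2 μ)
    (hh : MemLp h 2 μ) (hlim : Tendsto (fun N => eLpNorm (fun x => u x - f N x) 2 μ) atTop (𝓝 0)) :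
    Tendsto (fun N => ∫ x, f N x * h x ∂μ) atTop (𝓝 (∫ x, u x * h x ∂μ)) := by
  refine tendsto_integral_of_L1' _ (hu.integrable_mul hh).aestronglyMeasurable
    (Eventually.of_forall fun N => (hf N).integrable_mul hh) ?_
  have hle : ∀ N, eLpNorm ((fun x => f N x * h x) - fun x => u x * h x) 1 μ ≤
      eLpNorm (fun x => u x - f N x) 2 μ * eLpNorm h 2 μ := by
    intro N
    have h1 : ((fun x => f N x * h x) - fun x => u x * h x) =
        -((fun x => u x - f N x) • h) := by
      ext x; simp; ring
    rw [h1, eLpNorm_neg]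
    exact eLpNorm_smul_le_mul_eLpNorm hh.1 (hu.sub (hf N)).1
  refine tendsto_of_tendsto_of_tendsto_of_le_of_le tendsto_const_nhds ?_ (fun _ => zero_le)
    hle
  have := ENNReal.Tendsto.mul_const hlim (b := eLpNorm h 2 μ) (Or.inr hh.2.ne)
  simpa using this

variable {n : ℕ} [NeZero n] {a : Fin n → Plane} {K : Set Plane}

lemma memLp_weakPartial {u : Plane → ℝ} (hu : IsH1 K u) (j : Fin 2) :
    MemLp (weakPartial K j u) 2 (volume.restrict K) := by
  rw [weakPartial, dif_pos (hu.2 j)]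
  exact (hu.2 j).choose_spec.1

lemma integrable_mul_ev {u : Plane → ℝ} (hu : MemLp u 2 (volume.restrict K))
    (hK : Bornology.IsBounded K) (q : Poly) :
    Integrable (fun x => u x * ev q x) (volume.restrict K) :=
  hu.integrable_mul (memLp_of_continuous_of_isBounded (continuous_ev q) hK 2)

lemma continuous_edge (a : Fin n → Plane) (i : Fin n) :
    Continuous fun t : ℝ => (AffineMap.lineMap (a i) (a (i + 1)) t : Plane) :=
  AffineMap.lineMap_continuous

lemma memLp_comp_edge {h : Plane → ℝ} (hh : Continuous h) (i : Fin n) :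
    MemLp (fun t : ℝ => h (AffineMap.lineMap (a i) (a (i + 1)) t)) 2
      (volume.restrict (Set.Icc (0 : ℝ) 1)) := by
  have hc := hh.comp (continuous_edge a i)
  obtain ⟨C, hC⟩ := (isCompact_Icc (a := (0 : ℝ)) (b := 1)).exists_bound_of_continuousOn
    hc.continuousOn
  exact MemLp.of_bound hc.aestronglyMeasurable C
    ((ae_restrict_iff' measurableSet_Icc).2 (Eventually.of_forall hC))

lemma IsBoundaryPoly.memLp_comp_edge {k : ℕ} {g : Plane → ℝ} (hg : IsBoundaryPoly a K k g)
    (i : Fin n) :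
    MemLp (fun t : ℝ => g (AffineMap.lineMap (a i) (a (i + 1)) t)) 2
      (volume.restrict (Set.Icc (0 : ℝ) 1)) := by
  obtain ⟨p, -, hp⟩ := hg.2 i
  refine (VEM.memLp_comp_edge (a := a) (continuous_ev p) i).ae_eq ?_
  refine (ae_restrict_iff' measurableSet_Icc).2 (Eventually.of_forall fun t ht => ?_)
  exact (hp _ (lineMap_mem_edge a i ht)).symm

/-- Green's formula on a star-shaped polygon, for polynomials and, by approximation, for `H¹`
functions with piecewise polynomial trace. -/
theorem IsPolygon.exists_green (hK : IsPolygon a K) (hstar : StarShapedBall K) :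
    ∃ σ : ℝ, (σ = 1 ∨ σ = -1) ∧
      (∀ (p : Poly) (j : Fin 2), ∫ x in K, ev (MvPolynomial.pderiv j p) x =
        ∑ i, σ * edgeNormal a i j *
          ∫ t in (0 : ℝ)..1, ev p (AffineMap.lineMap (a i) (a (i + 1)) t)) ∧
      ∀ (k : ℕ) (u g : Plane → ℝ), IsH1 K u → HasTrace a K u g → IsBoundaryPoly a K k g →
        ∀ (q : Poly) (j : Fin 2),
          ∫ x in K, weakPartial K j u x * ev q x =
            ∑ i, σ * edgeNormal a i j * (∫ t in (0 : ℝ)..1,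
              g (AffineMap.lineMap (a i) (a (i + 1)) t) *
                ev q (AffineMap.lineMap (a i) (a (i + 1)) t)) -
            ∫ x in K, u x * ev (MvPolynomial.pderiv j q) x := by
  obtain ⟨σ, hσ, hgg⟩ := hK.exists_gaussGreen hstar
  refine ⟨σ, hσ, fun p j => ?_, fun k u g hu htr hg q j => ?_⟩
  · simp_rw [← pd_ev]
    exact hgg _ (contDiff_ev p) j
  obtain ⟨f, hf, hf0, hf1, hfb⟩ := htr
  have hb := hK.isBounded
  have hsmooth : ∀ N, ∫ x in K, pd j (f N) x * ev q x =
      ∑ i, σ * edgeNormal a i j * (∫ t in (0 : ℝ)..1,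
        f N (AffineMap.lineMap (a i) (a (i + 1)) t) *
          ev q (AffineMap.lineMap (a i) (a (i + 1)) t)) -
      ∫ x in K, f N x * ev (MvPolynomial.pderiv j q) x := by
    intro N
    have h1 := hgg (fun x => f N x * ev q x) ((hf N).mul (contDiff_ev q)) j
    have h2 : ∀ x, pd j (fun x => f N x * ev q x) x =
        pd j (f N) x * ev q x + f N x * ev (MvPolynomial.pderiv j q) x := by
      intro x
      rw [← pd_ev]
      unfold pd
      rw [fderiv_fun_mul ((hf N).differentiable (by simp) x)
        ((contDiff_ev q).differentiable (by simp) x)]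
      simp; ring
    simp_rw [h2] at h1
    rw [integral_add (integrableOn_of_continuous_of_isBounded
        (h := fun x => pd j (f N) x * ev q x)
          ((continuous_pd (hf N) j).mul (continuous_ev q)) hb)
      (integrableOn_of_continuous_of_isBounded
        (h := fun x => f N x * ev (MvPolynomial.pderiv j q) x)
          ((hf N).continuous.mul (continuous_ev _)) hb)] at h1
    rw [← h1]; ring
  have hL : Tendsto (fun N => ∫ x in K, pd j (f N) x * ev q x) atTop
      (𝓝 (∫ x in K, weakPartial K j u x * ev q x)) :=
    tendsto_integral_mul_of_tendsto_eLpNorm (memLp_weakPartial hu j)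
      (fun N => memLp_of_continuous_of_isBounded (continuous_pd (hf N) j) hb 2)
      (memLp_of_continuous_of_isBounded (continuous_ev q) hb 2) (hf1 j)
  have hR : Tendsto (fun N => ∫ x in K, f N x * ev (MvPolynomial.pderiv j q) x) atTop
      (𝓝 (∫ x in K, u x * ev (MvPolynomial.pderiv j q) x)) :=
    tendsto_integral_mul_of_tendsto_eLpNorm hu.1
      (fun N => memLp_of_continuous_of_isBounded (hf N).continuous hb 2)
      (memLp_of_continuous_of_isBounded (continuous_ev _) hb 2) hf0
  have hB : ∀ i, Tendsto (fun N => ∫ t in (0 : ℝ)..1,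
        f N (AffineMap.lineMap (a i) (a (i + 1)) t) *
          ev q (AffineMap.lineMap (a i) (a (i + 1)) t)) atTop
      (𝓝 (∫ t in (0 : ℝ)..1, g (AffineMap.lineMap (a i) (a (i + 1)) t) *
          ev q (AffineMap.lineMap (a i) (a (i + 1)) t))) := by
    intro i
    simp_rw [intervalIntegral.integral_of_le (zero_le_one' ℝ), ← integral_Icc_eq_integral_Ioc]
    exact tendsto_integral_mul_of_tendsto_eLpNorm (hg.memLp_comp_edge i)
      (fun N => memLp_comp_edge (hf N).continuous i) (memLp_comp_edge (continuous_ev q) i) (hfb i)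
  refine tendsto_nhds_unique hL ?_
  simp_rw [hsmooth]
  exact (tendsto_finsetSum _ fun i _ => (hB i).const_mul _).sub hR

end Green

end VEM

namespace VEM

open MvPolynomial

/-! ### Polynomials of bounded degree -/

section Degree

lemma mem_polyLE {m : ℤ} {p : Poly} : p ∈ polyLE m ↔ ∀ e, p.coeff e ≠ 0 → (e.degree : ℤ) ≤ m := by
  rw [polyLE, mem_restrictSupport_iff]
  simp only [Set.subset_def, Finset.mem_coe, mem_support_iff, Set.mem_ofPred_eq]

lemma polyLE_mono {m m' : ℤ} (h : m ≤ m') : polyLE m ≤ polyLE m' := fun _ hp =>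
  mem_polyLE.2 fun e he => (mem_polyLE.1 hp e he).trans h

lemma monomial_mem_polyLE {m : ℤ} {e : Fin 2 →₀ ℕ} (he : (e.degree : ℤ) ≤ m) (r : ℝ) :
    (monomial e r : Poly) ∈ polyLE m := by
  refine mem_polyLE.2 fun e' he' => ?_
  rw [coeff_monomial] at he'
  split_ifs at he' with h
  · exact h ▸ he
  · exact absurd rfl he'

lemma pderiv_mem_polyLE {m : ℤ} {p : Poly} (hp : p ∈ polyLE m) (j : Fin 2) :
    pderiv j p ∈ polyLE (m - 1) := by
  refine mem_polyLE.2 fun e he => ?_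
  rw [coeff_pderiv] at he
  have := mem_polyLE.1 hp _ (left_ne_zero_of_mul he)
  rw [map_add, Finsupp.degree_single] at this
  push_cast at this
  linarith

lemma finite_degree_le (m : ℤ) : {e : Fin 2 →₀ ℕ | (e.degree : ℤ) ≤ m}.Finite :=
  (Finsupp.finite_of_degree_le m.toNat).subset fun e he => by
    simp only [Set.mem_ofPred_eq] at he ⊢; omega

/-- The exponents of total degree at most `m`. -/
noncomputable def exps (m : ℤ) : Finset (Fin 2 →₀ ℕ) := (finite_degree_le m).toFinset

lemma mem_exps {m : ℤ} {e : Fin 2 →₀ ℕ} : e ∈ exps m ↔ (e.degree : ℤ) ≤ m := by simp [exps]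

lemma eq_sum_exps {m : ℤ} {p : Poly} (hp : p ∈ polyLE m) :
    p = ∑ e : exps m, p.coeff e • (monomial (e : Fin 2 →₀ ℕ) 1 : Poly) := by
  conv_lhs => rw [p.as_sum]
  rw [Finset.sum_coe_sort (exps m) fun e => p.coeff e • (monomial e 1 : Poly)]
  simp_rw [smul_monomial, smul_eq_mul, mul_one]
  refine Finset.sum_subset (fun e he => ?_) fun e _ he => ?_
  · exact mem_exps.2 (mem_polyLE.1 hp e (mem_support_iff.1 he))
  · rw [notMem_support_iff.1 he, monomial_zero]

lemma polyLE_induction {m : ℤ} {W : Submodule ℝ Poly}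
    (h : ∀ e : Fin 2 →₀ ℕ, (e.degree : ℤ) ≤ m → (monomial e 1 : Poly) ∈ W) : polyLE m ≤ W := by
  intro p hp
  rw [eq_sum_exps hp]
  exact W.sum_mem fun e _ => W.smul_mem _ (h e (mem_exps.1 e.2))

instance (m : ℤ) : FiniteDimensional ℝ (polyLE m) :=
  have : Finite {e : Fin 2 →₀ ℕ | (e.degree : ℤ) ≤ m} := (finite_degree_le m).to_subtype
  Module.Finite.of_basis (basisRestrictSupport ℝ {e : Fin 2 →₀ ℕ | (e.degree : ℤ) ≤ m})

lemma eq_C_of_pderiv_eq_zero {p : Poly} (h : ∀ j, pderiv j p = 0) : p = C (p.coeff 0) := by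
  ext e
  rw [coeff_C]
  split_ifs with he
  · rw [← he]
  · obtain ⟨j, hj⟩ : ∃ j, e j ≠ 0 := by
      by_contra! hcon
      exact he (Finsupp.ext fun j => (hcon j).symm)
    have hle : Finsupp.single j 1 ≤ e := by
      rw [Finsupp.single_le_iff]; omega
    have := congrArg (coeff (e - Finsupp.single j 1)) (h j)
    rw [coeff_pderiv, tsub_add_cancel_of_le hle, coeff_zero] at this
    refine (mul_eq_zero.1 this).resolve_right ?_
    positivity

end Degree

/-! ### Linear systems over the data field -/

section Rational

variable {F : Subfield ℝ}

/-- The polynomial has its coefficients in `F`. -/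
def HasCoeffsIn (F : Subfield ℝ) (p : Poly) : Prop := ∀ e, p.coeff e ∈ F

lemma HasCoeffsIn.mul {p q : Poly} (hp : HasCoeffsIn F p) (hq : HasCoeffsIn F q) :
    HasCoeffsIn F (p * q) := fun e => by
  rw [coeff_mul]; exact F.sum_mem fun x _ => F.mul_mem (hp _) (hq _)

lemma hasCoeffsIn_monomial (e : Fin 2 →₀ ℕ) {r : ℝ} (hr : r ∈ F) :
    HasCoeffsIn F (monomial e r) := fun e' => by
  rw [coeff_monomial]
  split_ifs
  exacts [hr, F.zero_mem]

lemma hasCoeffsIn_one : HasCoeffsIn F 1 := hasCoeffsIn_monomial 0 F.one_mem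

lemma hasCoeffsIn_X (j : Fin 2) : HasCoeffsIn F (X j) := hasCoeffsIn_monomial _ F.one_mem

lemma HasCoeffsIn.pderiv {p : Poly} (hp : HasCoeffsIn F p) (j : Fin 2) :
    HasCoeffsIn F (pderiv j p) := fun e => by
  rw [coeff_pderiv]
  exact F.mul_mem (hp _) (F.add_mem (natCast_mem F _) F.one_mem)

/-- A linear functional with values in `F` on the monomials has values in `F` on the polynomials
with coefficients in `F`. -/
lemma HasCoeffsIn.map_mem {p : Poly} (hp : HasCoeffsIn F p) {L : Poly →ₗ[ℝ] ℝ}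
    (hL : ∀ e, L (monomial e 1) ∈ F) : L p ∈ F := by
  rw [p.as_sum, map_sum]
  refine F.sum_mem fun e _ => ?_
  have : (monomial e (p.coeff e) : Poly) = p.coeff e • monomial e 1 := by
    rw [smul_monomial, smul_eq_mul, mul_one]
  rw [this, map_smul, smul_eq_mul]
  exact F.mul_mem (hp e) (hL e)

variable {S : Type*} {V : Submodule F (S → ℝ)}

lemma mul_mem_of_mem {r : ℝ} (hr : r ∈ F) {f : S → ℝ} (hf : f ∈ V) : (fun s => r * f s) ∈ V :=
  V.smul_mem (⟨r, hr⟩ : F) hf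

/-- If a linear system with coefficients in `F` determines its real solution uniquely, then the
solution depends `F`-linearly on the right-hand side: a left inverse of the coefficient matrix
exists over `F`. -/
lemma mem_of_injective_system {ι κ : Type*} [Fintype ι] [Fintype κ] {M : ι → κ → ℝ}
    (hM : ∀ i j, M i j ∈ F) (hinj : ∀ y : κ → ℝ, (∀ i, ∑ j, M i j * y j = 0) → y = 0)
    {x : κ → S → ℝ} (hx : ∀ i, (fun s => ∑ j, M i j * x j s) ∈ V) (j : κ) : x j ∈ V := by
  classical
  let A : Matrix ι κ F := Matrix.of fun i j => ⟨M i j, hM i j⟩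
  have hker : LinearMap.ker A.mulVecLin = ⊥ := by
    rw [LinearMap.ker_eq_bot']
    intro y hy
    have h0 : (fun j => (y j : ℝ)) = 0 := hinj _ fun i => by
      have := congrArg (fun z : F => (z : ℝ)) (congrFun hy i)
      simpa [A, Matrix.mulVec, dotProduct] using this
    ext j
    exact congrFun h0 j
  obtain ⟨N, hN⟩ := LinearMap.exists_leftInverse_of_injective A.mulVecLin hker
  let B := LinearMap.toMatrix' N
  have hBA : B * A = 1 := by
    have h1 := congrArg LinearMap.toMatrix' hN
    rw [LinearMap.toMatrix'_comp, LinearMap.toMatrix'_id] at h1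
    rwa [show LinearMap.toMatrix' A.mulVecLin = A from LinearMap.toMatrix'_toLin' A] at h1
  have hBA' : ∀ j', ∑ i, (B j i : ℝ) * M i j' = if j = j' then 1 else 0 := by
    intro j'
    have := congrArg (fun z : F => (z : ℝ)) (congrFun (congrFun hBA j) j')
    simp only [Matrix.mul_apply, Matrix.one_apply] at this
    rw [apply_ite (fun z : F => (z : ℝ))] at this
    simpa [A] using this
  have : x j = ∑ i, B j i • fun s => ∑ j, M i j * x j s := by
    ext s
    simp only [Finset.sum_apply, Pi.smul_apply, Subfield.smul_def, smul_eq_mul, Finset.mul_sum,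
      ← mul_assoc]
    rw [Finset.sum_comm]
    simp_rw [← Finset.sum_mul, hBA']
    simp
  rw [this]
  exact V.sum_mem fun i _ => V.smul_mem _ (hx i)

/-- The coefficients of the polynomial valued function `P` belong to `V`. -/
def HasCoeffsMem (V : Submodule F (S → ℝ)) (P : S → Poly) : Prop :=
  ∀ e, (fun s => (P s).coeff e) ∈ V

/-- Polynomials of degree at most `m` that are determined by finitely many functionals over `F`
with values in `V` have their coefficients in `V`. -/
lemma hasCoeffsMem_of_system {ι : Type*} [Fintype ι] {m : ℤ} {L : ι → Poly →ₗ[ℝ] ℝ}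
    (hL : ∀ i e, L i (monomial e 1) ∈ F)
    (hinj : ∀ p ∈ polyLE m, (∀ i, L i p = 0) → p = 0) {P : S → Poly}
    (hP : ∀ s, P s ∈ polyLE m) (hb : ∀ i, (fun s => L i (P s)) ∈ V) : HasCoeffsMem V P := by
  intro e
  by_cases he : e ∈ exps m
  · refine mem_of_injective_system (κ := exps m) (M := fun i e => L i (monomial (e : Fin 2 →₀ ℕ) 1))
      (x := fun e s => (P s).coeff (e : Fin 2 →₀ ℕ)) (fun i e => hL i e) (fun y hy => ?_)
      (fun i => ?_) ⟨e, he⟩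
    · let p : Poly := ∑ e : exps m, y e • monomial (e : Fin 2 →₀ ℕ) 1
      have hpm : p ∈ polyLE m := Submodule.sum_mem _ fun e _ =>
        Submodule.smul_mem _ _ (monomial_mem_polyLE (mem_exps.1 e.2) 1)
      have hp0 : p = 0 := hinj p hpm fun i => by
        rw [← hy i, map_sum]
        exact Finset.sum_congr rfl fun e _ => by rw [map_smul, smul_eq_mul, mul_comm]
      ext e
      have := congrArg (coeff (e : Fin 2 →₀ ℕ)) hp0
      simpa [p, coeff_sum, coeff_monomial, ← Subtype.ext_iff] using this
    · convert hb i using 2 with s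
      conv_rhs => rw [eq_sum_exps (hP s)]
      rw [map_sum]
      exact Finset.sum_congr rfl fun e _ => by rw [map_smul, smul_eq_mul, mul_comm]
  · have : (fun s => (P s).coeff e) = 0 := by
      ext s
      by_contra h
      exact he (mem_exps.2 (mem_polyLE.1 (hP s) e h))
    rw [this]
    exact V.zero_mem

/-- Applying a functional over `F` to polynomials with coefficients in `V`. -/
lemma HasCoeffsMem.map_mem {m : ℤ} {P : S → Poly} (hc : HasCoeffsMem V P)
    (hP : ∀ s, P s ∈ polyLE m) {L : Poly →ₗ[ℝ] ℝ} (hL : ∀ e, L (monomial e 1) ∈ F) :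
    (fun s => L (P s)) ∈ V := by
  have : (fun s => L (P s)) = ∑ e : exps m, fun s => L (monomial (e : Fin 2 →₀ ℕ) 1) *
      (P s).coeff (e : Fin 2 →₀ ℕ) := by
    ext s
    conv_lhs => rw [eq_sum_exps (hP s)]
    rw [map_sum, Finset.sum_apply]
    exact Finset.sum_congr rfl fun e _ => by rw [map_smul, smul_eq_mul, mul_comm]
  rw [this]
  exact V.sum_mem fun e _ => mul_mem_of_mem (hL e) (hc e)

end Rational

/-- The Riesz representation of a functional on a finite-dimensional space of polynomials. -/
lemma exists_mem_forall_eq (W : Submodule ℝ Poly) [FiniteDimensional ℝ W]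
    {B : Poly →ₗ[ℝ] Poly →ₗ[ℝ] ℝ} (hB : ∀ p, B p p = 0 → p = 0) (l : Poly →ₗ[ℝ] ℝ) :
    ∃ p ∈ W, ∀ q ∈ W, B p q = l q := by
  let φ : W →ₗ[ℝ] Module.Dual ℝ W := W.subtype.dualMap ∘ₗ B ∘ₗ W.subtype
  have hinj : Function.Injective φ := by
    rw [← LinearMap.ker_eq_bot, LinearMap.ker_eq_bot']
    intro p hp
    exact Subtype.ext (hB p (LinearMap.congr_fun hp p))
  have hsurj := (LinearMap.injective_iff_surjective_of_finrank_eq_finrank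
    Subspace.dual_finrank_eq.symm).1 hinj
  obtain ⟨p, hp⟩ := hsurj (l ∘ₗ W.subtype)
  exact ⟨p, p.2, fun q hq => LinearMap.congr_fun hp ⟨q, hq⟩⟩

/-- A form that is definite determines a polynomial by its products with a spanning family. -/
lemma eq_zero_of_forall_span_eq_zero {ι : Type*} {W : Submodule ℝ Poly}
    {B : Poly →ₗ[ℝ] Poly →ₗ[ℝ] ℝ} (hB : ∀ p, B p p = 0 → p = 0) {b : ι → Poly}
    (hb : Submodule.span ℝ (Set.range b) = W) {p : Poly} (hp : p ∈ W) (h : ∀ i, B p (b i) = 0) :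
    p = 0 := by
  have : W ≤ LinearMap.ker (B p) := by
    rw [← hb, Submodule.span_le]
    rintro _ ⟨i, rfl⟩
    exact h i
  exact hB p (this hp)

/-- Consider functionals on `polyLE M` that vanish on the `B`-orthogonal complement of `polyLE m`.
Their values at polynomials over `F` are determined `F`-linearly by their values on a
generating family of `polyLE m` with coefficients in `F`. -/
lemma mem_of_forall_orthogonal {F : Subfield ℝ} {S : Type*} {V : Submodule F (S → ℝ)} {ι : Type*}
    [Fintype ι] {m M : ℤ} (hmM : m ≤ M) {B : Poly →ₗ[ℝ] Poly →ₗ[ℝ] ℝ}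
    (hBF : ∀ p q, HasCoeffsIn F p → HasCoeffsIn F q → B p q ∈ F)
    (hB : ∀ p, B p p = 0 → p = 0) (hBsymm : ∀ p q, B p q = B q p) {b : ι → Poly}
    (hb : Submodule.span ℝ (Set.range b) = polyLE m) (hbF : ∀ i, HasCoeffsIn F (b i))
    {l : S → Poly →ₗ[ℝ] ℝ} (hl : ∀ i, (fun s => l s (b i)) ∈ V)
    (horth : ∀ s, ∀ g ∈ polyLE M, (∀ h ∈ polyLE m, B g h = 0) → l s g = 0) {q : Poly}
    (hq : q ∈ polyLE M) (hqF : HasCoeffsIn F q) : (fun s => l s q) ∈ V := by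
  choose y hym hy using fun s => exists_mem_forall_eq (polyLE m) hB (l s)
  have hbm : ∀ i, b i ∈ polyLE m := fun i => hb ▸ Submodule.subset_span ⟨i, rfl⟩
  have hyc : HasCoeffsMem V y := by
    refine hasCoeffsMem_of_system (L := fun i => B (b i)) (fun i e => hBF _ _ (hbF i)
      (hasCoeffsIn_monomial e F.one_mem)) (fun p hp h => ?_) hym fun i => ?_
    · exact eq_zero_of_forall_span_eq_zero hB hb hp fun i => by rw [hBsymm, h i]
    · convert hl i using 2 with s
      rw [hBsymm, hy s _ (hbm i)]
  obtain ⟨q', hq'm, hq'⟩ := exists_mem_forall_eq (polyLE m) hB (B q)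
  have key : ∀ s, l s q = B q (y s) := by
    intro s
    have h0 : l s (q - q') = 0 := horth s _ (Submodule.sub_mem _ hq (polyLE_mono hmM hq'm))
      fun h hh => by rw [map_sub, LinearMap.sub_apply, hq' h hh, sub_self]
    rw [map_sub, sub_eq_zero] at h0
    rw [h0, ← hy s q' hq'm, hBsymm, hq' _ (hym s)]
  simp_rw [key]
  exact hyc.map_mem hym fun e => hBF _ _ hqF (hasCoeffsIn_monomial e F.one_mem)

/-! ### Computing the moments of a field -/

section Moments

/-- The bilinear form `(p, q) ↦ J (p q)`. -/
noncomputable def mulForm (J : Poly →ₗ[ℝ] ℝ) : Poly →ₗ[ℝ] Poly →ₗ[ℝ] ℝ :=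
  (LinearMap.mul ℝ Poly).compr₂ J

@[simp] lemma mulForm_apply (J : Poly →ₗ[ℝ] ℝ) (p q : Poly) : mulForm J p q = J (p * q) := rfl

/-- The bilinear form of the fields `x^⊥ p` and `x^⊥ q`. -/
noncomputable def rotForm (J : Poly →ₗ[ℝ] ℝ) : Poly →ₗ[ℝ] Poly →ₗ[ℝ] ℝ :=
  ∑ j, (mulForm J).compl₁₂ (LinearMap.mulLeft ℝ (X j)) (LinearMap.mulLeft ℝ (X j))

lemma rotForm_apply (J : Poly →ₗ[ℝ] ℝ) (p q : Poly) :
    rotForm J p q = ∑ j, J ((X j * p) * (X j * q)) := by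
  simp [rotForm]

/-- The functional `p ↦ ∫ v · x^⊥ p`, where `μ c` is integration against the component `v c`. -/
noncomputable def rotMoment (μ : Fin 2 → Poly →ₗ[ℝ] ℝ) : Poly →ₗ[ℝ] ℝ :=
  μ 0 ∘ₗ LinearMap.mulLeft ℝ (X 1) - μ 1 ∘ₗ LinearMap.mulLeft ℝ (X 0)

lemma rotMoment_apply (μ : Fin 2 → Poly →ₗ[ℝ] ℝ) (p : Poly) :
    rotMoment μ p = μ 0 (X 1 * p) - μ 1 (X 0 * p) := rfl

variable {F : Subfield ℝ} {S : Type*} {V : Submodule F (S → ℝ)} {J : Poly →ₗ[ℝ] ℝ}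

lemma map_mul_mem (hJF : ∀ e, J (monomial e 1) ∈ F) {p q : Poly} (hp : HasCoeffsIn F p)
    (hq : HasCoeffsIn F q) : J (p * q) ∈ F := (hp.mul hq).map_mem hJF

lemma rotForm_mem (hJF : ∀ e, J (monomial e 1) ∈ F) {p q : Poly} (hp : HasCoeffsIn F p)
    (hq : HasCoeffsIn F q) : rotForm J p q ∈ F := by
  rw [rotForm_apply]
  exact F.sum_mem fun j _ => map_mul_mem hJF ((hasCoeffsIn_X j).mul hp) ((hasCoeffsIn_X j).mul hq)

lemma rotForm_symm (p q : Poly) : rotForm J p q = rotForm J q p := by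
  simp_rw [rotForm_apply]
  exact Finset.sum_congr rfl fun j _ => by rw [mul_comm]

lemma eq_zero_of_rotForm_self (hJ0 : ∀ p, 0 ≤ J (p * p)) (hJ : ∀ p, J (p * p) = 0 → p = 0)
    {p : Poly} (h : rotForm J p p = 0) : p = 0 := by
  rw [rotForm_apply, Finset.sum_eq_zero_iff_of_nonneg fun j _ => hJ0 _] at h
  exact (mul_eq_zero.1 (hJ _ (h 0 (Finset.mem_univ _)))).resolve_left (X_ne_zero _)

/-- The moments of a field against gradients are known as soon as its boundary integrals and the
divergence moments are: the divergence is a polynomial, recovered from its moments. -/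
lemma grad_moment_mem (hJF : ∀ e, J (monomial e 1) ∈ F) (hJ : ∀ p, J (p * p) = 0 → p = 0)
    {μ : S → Fin 2 → Poly →ₗ[ℝ] ℝ} {dv : S → Fin 2 → Fin 2 → Poly →ₗ[ℝ] ℝ}
    (hG : ∀ c j q, HasCoeffsIn F q → (fun s => dv s c j q + μ s c (pderiv j q)) ∈ V)
    {m : ℤ} {D : S → Poly} (hDm : ∀ s, D s ∈ polyLE m)
    (hD : ∀ s q, ∑ j, dv s j j q = J (D s * q)) {ι : Type*} [Fintype ι] {b : ι → Poly}
    (hb : Submodule.span ℝ (insert 1 (Set.range b)) = polyLE m) (hbF : ∀ i, HasCoeffsIn F (b i))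
    (hdof : ∀ i, (fun s => J (D s * b i)) ∈ V) {q : Poly} (hq : HasCoeffsIn F q) :
    (fun s => ∑ j, μ s j (pderiv j q)) ∈ V := by
  have hsum : ∀ q, HasCoeffsIn F q →
      (fun s => J (D s * q) + ∑ j, μ s j (pderiv j q)) ∈ V := by
    intro q hq
    have h1 := V.sum_mem (t := Finset.univ) fun j _ => hG j j q hq
    convert h1 using 1
    ext s
    rw [Finset.sum_apply, Finset.sum_add_distrib, hD]
  let b' : Option ι → Poly := fun o => o.elim 1 b
  have hb' : Submodule.span ℝ (Set.range b') = polyLE m := by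
    rw [← hb]
    congr 1
    ext p
    simp [b', eq_comm, Option.exists]
  have hb'F : ∀ o, HasCoeffsIn F (b' o) := by
    rintro (_ | i)
    exacts [hasCoeffsIn_one, hbF i]
  have hDc : HasCoeffsMem V D := by
    refine hasCoeffsMem_of_system (L := fun o => mulForm J (b' o)) (fun o e =>
      map_mul_mem hJF (hb'F o) (hasCoeffsIn_monomial e F.one_mem)) (fun p hp h => ?_) hDm ?_
    · refine eq_zero_of_forall_span_eq_zero (B := mulForm J) hJ hb' hp fun o => ?_
      have := h o
      rwa [mulForm_apply, mul_comm] at this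
    · rintro (_ | i)
      · have := hsum 1 hasCoeffsIn_one
        simpa [b', mul_comm] using this
      · simpa [b', mul_comm] using hdof i
  have h2 := V.sub_mem (hsum q hq) (hDc.map_mem hDm (L := mulForm J q) fun e =>
    map_mul_mem hJF hq (hasCoeffsIn_monomial e F.one_mem))
  convert h2 using 1
  ext s
  simp [mul_comm]

/-- The decomposition `[P_m]² = ∇ P_{m+1} + x^⊥ P_{m-1}`: Euler's identity gives
`(d + 1) q = ∇ (x · q) - x^⊥ rot q` for homogeneous fields `q` of degree `d`. -/
lemma moment_mem_of_grad_of_rot {μ : S → Fin 2 → Poly →ₗ[ℝ] ℝ} {m : ℤ}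
    (hgrad : ∀ q, HasCoeffsIn F q → (fun s => ∑ j, μ s j (pderiv j q)) ∈ V)
    (hrot : ∀ q ∈ polyLE (m - 1), HasCoeffsIn F q → (fun s => rotMoment (μ s) q) ∈ V)
    {q : Poly} (hq : q ∈ polyLE m) (hqF : HasCoeffsIn F q) (c : Fin 2) :
    (fun s => μ s c q) ∈ V := by
  have hmono : ∀ e : Fin 2 →₀ ℕ, (e.degree : ℤ) ≤ m → (fun s => μ s c (monomial e 1)) ∈ V := by
    intro e he
    set M : Poly := monomial e 1 with hM
    have hMF : HasCoeffsIn F M := hasCoeffsIn_monomial e F.one_mem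
    have hMm : M ∈ polyLE m := monomial_mem_polyLE he 1
    have heuler : ∑ i, X i * pderiv i M = e.degree • M :=
      (isHomogeneous_monomial (1 : ℝ) rfl).sum_X_mul_pderiv
    rw [Fin.sum_univ_two] at heuler
    have hd : (0 : ℝ) < e.degree + 1 := by positivity
    have hinv : ((e.degree : ℝ) + 1)⁻¹ ∈ F :=
      F.inv_mem (F.add_mem (natCast_mem F _) F.one_mem)
    have hg := hgrad (X c * M) ((hasCoeffsIn_X c).mul hMF)
    fin_cases c
    · have hr := hrot _ (pderiv_mem_polyLE hMm 1) (hMF.pderiv 1)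
      convert mul_mem_of_mem hinv (V.add_mem hg hr) using 1
      ext s
      have h1 : X 1 * pderiv 1 M = e.degree • M - X 0 * pderiv 0 M := by rw [← heuler]; ring
      simp only [Fin.zero_eta, Pi.add_apply, Fin.sum_univ_two, rotMoment_apply, h1,
        Derivation.leibniz, pderiv_X_self, pderiv_X_of_ne (zero_ne_one : (0 : Fin 2) ≠ 1),
        smul_eq_mul, mul_one, mul_zero, map_add, map_sub, map_nsmul,
        map_zero]
      field_simp
      simp only [nsmul_eq_mul]
      ring
    · have hr := hrot _ (pderiv_mem_polyLE hMm 0) (hMF.pderiv 0)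
      convert mul_mem_of_mem hinv (V.sub_mem hg hr) using 1
      ext s
      have h1 : X 0 * pderiv 0 M = e.degree • M - X 1 * pderiv 1 M := by rw [← heuler]; ring
      simp only [Fin.mk_one, Pi.sub_apply, Fin.sum_univ_two, rotMoment_apply, h1,
        Derivation.leibniz, pderiv_X_self, pderiv_X_of_ne (one_ne_zero : (1 : Fin 2) ≠ 0),
        smul_eq_mul, mul_one, mul_zero, map_add, map_sub, map_nsmul,
        map_zero]
      field_simp
      simp only [nsmul_eq_mul]
      ring
  have : (fun s => μ s c q) = ∑ e : exps m, fun s =>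
      q.coeff (e : Fin 2 →₀ ℕ) * μ s c (monomial (e : Fin 2 →₀ ℕ) 1) := by
    ext s
    conv_lhs => rw [eq_sum_exps hq]
    rw [map_sum, Finset.sum_apply]
    exact Finset.sum_congr rfl fun e _ => by rw [map_smul, smul_eq_mul]
  rw [this]
  exact V.sum_mem fun e _ => mul_mem_of_mem (hqF _) (hmono e (mem_exps.1 e.2))

/-- The energy projection of one component is computable from the moments of degree at most
`k - 2` and the boundary integrals. -/
lemma hasCoeffsMem_energyProjection (hJF : ∀ e, J (monomial e 1) ∈ F) (hJ0 : ∀ p, 0 ≤ J (p * p))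
    (hJ : ∀ p, J (p * p) = 0 → p = 0) {k : ℤ} (hk : 2 ≤ k) {μ : S → Poly →ₗ[ℝ] ℝ}
    {dv : S → Fin 2 → Poly →ₗ[ℝ] ℝ}
    (hG : ∀ j q, HasCoeffsIn F q → (fun s => dv s j q + μ s (pderiv j q)) ∈ V)
    (hlow : ∀ q ∈ polyLE (k - 2), HasCoeffsIn F q → (fun s => μ s q) ∈ V) {P : S → Poly}
    (hP : ∀ s, P s ∈ polyLE k)
    (hen : ∀ s, ∀ q ∈ polyLE k, ∑ j, dv s j (pderiv j q) = ∑ j, J (pderiv j q * pderiv j (P s)))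
    (hmean : ∀ s, μ s 1 = J (P s)) : HasCoeffsMem V P := by
  let B : Poly →ₗ[ℝ] Poly →ₗ[ℝ] ℝ := ∑ j, (mulForm J).compl₁₂
    (pderiv j : Derivation ℝ Poly Poly).toLinearMap (pderiv j : Derivation ℝ Poly Poly).toLinearMap
  have hB : ∀ p q, B p q = ∑ j, J (pderiv j p * pderiv j q) := fun p q => by simp [B]
  have hBsymm : ∀ p q, B p q = B q p := fun p q => by
    rw [hB, hB]; exact Finset.sum_congr rfl fun j _ => by rw [mul_comm]
  let L : Option (exps k) → Poly →ₗ[ℝ] ℝ := fun o => o.elim J fun e =>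
    B (monomial (e : Fin 2 →₀ ℕ) 1)
  refine hasCoeffsMem_of_system (L := L) (m := k) ?_ (fun p hp h => ?_) hP ?_
  · rintro (_ | e) e'
    · exact hJF e'
    · change B _ _ ∈ F
      rw [hB]
      exact F.sum_mem fun j _ => map_mul_mem hJF ((hasCoeffsIn_monomial _ F.one_mem).pderiv j)
        ((hasCoeffsIn_monomial _ F.one_mem).pderiv j)
  · have hker : polyLE k ≤ LinearMap.ker (B p) := polyLE_induction fun e he => by
      rw [LinearMap.mem_ker, hBsymm]
      exact h (some ⟨e, mem_exps.2 he⟩)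
    have hself : B p p = 0 := hker hp
    rw [hB, Finset.sum_eq_zero_iff_of_nonneg fun j _ => hJ0 _] at hself
    have hconst := eq_C_of_pderiv_eq_zero fun j => hJ _ (hself j (Finset.mem_univ _))
    have hJ1 : J 1 ≠ 0 := fun h1 => one_ne_zero (hJ 1 (by rwa [mul_one]))
    have hmean0 : J p = 0 := h none
    rw [hconst, C_eq_smul_one, map_smul, smul_eq_mul] at hmean0
    rw [hconst, (mul_eq_zero.1 hmean0).resolve_right hJ1, C_0]
  · rintro (_ | e)
    · change (fun s => J (P s)) ∈ V
      simp_rw [← hmean]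
      refine hlow 1 ?_ hasCoeffsIn_one
      exact monomial_mem_polyLE (by simpa using by omega) 1
    · change (fun s => B (monomial (e : Fin 2 →₀ ℕ) 1) (P s)) ∈ V
      set M : Poly := monomial (e : Fin 2 →₀ ℕ) 1
      have hMF : HasCoeffsIn F M := hasCoeffsIn_monomial _ F.one_mem
      have hMm : M ∈ polyLE k := monomial_mem_polyLE (mem_exps.1 e.2) 1
      have h1 := V.sum_mem (t := Finset.univ) fun j _ => hG j _ (hMF.pderiv j)
      have h2 := V.sum_mem (t := Finset.univ) fun j _ => hlow (pderiv j (pderiv j M))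
        (by have := pderiv_mem_polyLE (pderiv_mem_polyLE hMm j) j
            rwa [sub_sub, one_add_one_eq_two] at this) ((hMF.pderiv j).pderiv j)
      convert V.sub_mem h1 h2 using 1
      ext s
      rw [hB, ← hen s M hMm]
      simp
      ring

/-- The moments up to degree `k` of fields whose energy projection has the same moments against
the part of `G_k^⊥` orthogonal to `G_{k-2}^⊥` are computable over `F`. -/
theorem moment_mem (hJF : ∀ e, J (monomial e 1) ∈ F) (hJ0 : ∀ p, 0 ≤ J (p * p))
    (hJ : ∀ p, J (p * p) = 0 → p = 0) {k : ℤ} (hk : 2 ≤ k) {μ : S → Fin 2 → Poly →ₗ[ℝ] ℝ}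
    {dv : S → Fin 2 → Fin 2 → Poly →ₗ[ℝ] ℝ}
    (hG : ∀ c j q, HasCoeffsIn F q → (fun s => dv s c j q + μ s c (pderiv j q)) ∈ V)
    {D : S → Poly} (hDm : ∀ s, D s ∈ polyLE (k - 1))
    (hD : ∀ s q, ∑ j, dv s j j q = J (D s * q)) {ι : Type*} [Fintype ι] {b : ι → Poly}
    (hb : Submodule.span ℝ (insert 1 (Set.range b)) = polyLE (k - 1))
    (hbF : ∀ i, HasCoeffsIn F (b i)) (hdof : ∀ i, (fun s => J (D s * b i)) ∈ V)
    {ι' : Type*} [Fintype ι'] {β : ι' → Poly}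
    (hβ : Submodule.span ℝ (Set.range β) = polyLE (k - 3)) (hβF : ∀ i, HasCoeffsIn F (β i))
    (hrot : ∀ i, (fun s => rotMoment (μ s) (β i)) ∈ V) {P : S → Fin 2 → Poly}
    (hP : ∀ s c, P s c ∈ polyLE k)
    (hen : ∀ s c, ∀ q ∈ polyLE k,
      ∑ j, dv s c j (pderiv j q) = ∑ j, J (pderiv j q * pderiv j (P s c)))
    (hmean : ∀ s c, μ s c 1 = J (P s c))
    (horth : ∀ s, ∀ g ∈ polyLE (k - 1), (∀ h ∈ polyLE (k - 3), rotForm J g h = 0) →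
      rotMoment (μ s) g = rotMoment (fun c => mulForm J (P s c)) g)
    {q : Poly} (hq : q ∈ polyLE k) (hqF : HasCoeffsIn F q) (c : Fin 2) :
    (fun s => μ s c q) ∈ V := by
  have hgrad := fun q (hq : HasCoeffsIn F q) => grad_moment_mem hJF hJ hG hDm hD hb hbF hdof hq
  have hBF : ∀ p q, HasCoeffsIn F p → HasCoeffsIn F q → rotForm J p q ∈ F :=
    fun _ _ => rotForm_mem hJF
  have hBdef : ∀ p, rotForm J p p = 0 → p = 0 := fun _ => eq_zero_of_rotForm_self hJ0 hJ
  have hlow : ∀ c, ∀ q ∈ polyLE (k - 2), HasCoeffsIn F q → (fun s => μ s c q) ∈ V := by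
    intro c q hq hqF
    refine moment_mem_of_grad_of_rot hgrad (fun q hq hqF => ?_) hq hqF c
    rw [sub_sub, show (2 : ℤ) + 1 = 3 by norm_num] at hq
    refine mem_of_forall_orthogonal le_rfl hBF hBdef rotForm_symm hβ hβF hrot
      (fun s g hg h => ?_) hq hqF
    rw [hBdef g (h g hg), map_zero]
  have hPc : ∀ c, HasCoeffsMem V fun s => P s c := fun c =>
    hasCoeffsMem_energyProjection hJF hJ0 hJ hk (hG c) (hlow c) (fun s => hP s c)
      (fun s => hen s c) fun s => hmean s c
  have hProt : ∀ p, HasCoeffsIn F p →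
      (fun s => rotMoment (fun c => mulForm J (P s c)) p) ∈ V := by
    intro p hp
    have hx : ∀ c j, (fun s => mulForm J (P s c) (X j * p)) ∈ V := fun c j => by
      have := (hPc c).map_mem (fun s => hP s c) (L := mulForm J (X j * p)) fun e =>
        map_mul_mem hJF ((hasCoeffsIn_X j).mul hp) (hasCoeffsIn_monomial e F.one_mem)
      simpa only [mulForm_apply, mul_comm] using this
    exact V.sub_mem (hx 0 1) (hx 1 0)
  refine moment_mem_of_grad_of_rot hgrad (fun q hq hqF => ?_) hq hqF c
  have h1 := mem_of_forall_orthogonal (V := V) (m := k - 3) (M := k - 1) (by omega) hBF hBdef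
    rotForm_symm hβ hβF (l := fun s => rotMoment (μ s) - rotMoment fun c => mulForm J (P s c))
    (fun i => V.sub_mem (hrot i) (hProt _ (hβF i)))
    (fun s g hg h => by rw [LinearMap.sub_apply, horth s g hg h, sub_self]) hq hqF
  convert V.add_mem h1 (hProt q hqF) using 1
  ext s
  simp

end Moments

/-! ### Boundary integrals -/

section Edge

variable {F : Subfield ℝ} {S : Type*} {V : Submodule F (S → ℝ)}

lemma integral_eval_mem {r : Polynomial ℝ} (hr : ∀ m, r.coeff m ∈ F) :
    ∫ t in (0 : ℝ)..1, r.eval t ∈ F := by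
  simp_rw [Polynomial.eval_eq_sum_range]
  rw [intervalIntegral.integral_finsetSum fun m _ =>
    (by fun_prop : Continuous fun t : ℝ => r.coeff m * t ^ m).intervalIntegrable _ _]
  refine F.sum_mem fun m _ => ?_
  rw [intervalIntegral.integral_const_mul, integral_pow]
  refine F.mul_mem (hr m) (F.div_mem ?_ (F.add_mem (natCast_mem F m) F.one_mem))
  rw [zero_pow (Nat.succ_ne_zero m), one_pow, sub_zero]
  exact F.one_mem

/-- Polynomials in one variable that are interpolated from values in `V` at nodes in `F` have
their weighted integrals in `V`: the Vandermonde system of the nodes is uniquely solvable. -/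
lemma integral_mul_mem_of_nodes {ι : Type*} [Fintype ι] {τ : ι → ℝ} (hτ : Function.Injective τ)
    (hτF : ∀ i, τ i ∈ F) {G : S → Polynomial ℝ} (hdeg : ∀ s, (G s).natDegree < Fintype.card ι)
    (hG : ∀ i, (fun s => (G s).eval (τ i)) ∈ V) {r : Polynomial ℝ} (hr : ∀ m, r.coeff m ∈ F) :
    (fun s => ∫ t in (0 : ℝ)..1, (G s).eval t * r.eval t) ∈ V := by
  set N := Fintype.card ι with hN
  have hcoeff : ∀ m : Fin N, (fun s => (G s).coeff m) ∈ V := by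
    refine mem_of_injective_system (M := fun i (m : Fin N) => τ i ^ (m : ℕ))
      (x := fun (m : Fin N) s => (G s).coeff m) (fun i m => F.pow_mem (hτF i) m)
      (fun y hy => ?_) fun i => ?_
    · -- a polynomial of degree less than the number of nodes that vanishes at all of them
      set p : Polynomial ℝ := ∑ m : Fin N, Polynomial.monomial (m : ℕ) (y m) with hp
      rcases Nat.eq_zero_or_pos N with h0 | hpos
      · ext m
        exact absurd m.2 (by omega)
      · have hpdeg : p.natDegree < N := by
          refine lt_of_le_of_lt (Polynomial.natDegree_sum_le_of_forall_le (n := N - 1) _ _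
            fun m _ => (Polynomial.natDegree_monomial_le _).trans ?_) (Nat.sub_lt hpos one_pos)
          omega
        have hp0 : p = 0 := Polynomial.eq_zero_of_natDegree_lt_card_of_eval_eq_zero p hτ
          (fun i => by
            rw [← hy i, hp, Polynomial.eval_finsetSum]
            simp [mul_comm]) hpdeg
        ext m
        have := congrArg (Polynomial.coeff · (m : ℕ)) hp0
        simpa [hp, Polynomial.coeff_monomial, Fin.val_inj] using this
    · convert hG i using 2 with s
      rw [Polynomial.eval_eq_sum_range' (hdeg s), Finset.sum_range]
      exact Finset.sum_congr rfl fun m _ => mul_comm _ _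
  have : (fun s => ∫ t in (0 : ℝ)..1, (G s).eval t * r.eval t) = ∑ m : Fin N, fun s =>
      (∫ t in (0 : ℝ)..1, (Polynomial.X ^ (m : ℕ) * r).eval t) * (G s).coeff m := by
    ext s
    simp_rw [Polynomial.eval_eq_sum_range' (hdeg s), Finset.sum_range, Finset.sum_mul]
    rw [intervalIntegral.integral_finsetSum fun (m : Fin N) _ =>
      (by fun_prop : Continuous fun t : ℝ =>
        (G s).coeff m * t ^ (m : ℕ) * r.eval t).intervalIntegrable _ _, Finset.sum_apply]
    refine Finset.sum_congr rfl fun m _ => ?_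
    simp_rw [mul_assoc, intervalIntegral.integral_const_mul, Polynomial.eval_mul,
      Polynomial.eval_pow, Polynomial.eval_X]
    rw [mul_comm]
  rw [this]
  refine V.sum_mem fun m _ => mul_mem_of_mem (integral_eval_mem fun l => ?_) (hcoeff m)
  rw [Polynomial.coeff_X_pow_mul']
  split_ifs
  exacts [hr _, F.zero_mem]

variable {n : ℕ} [NeZero n] {a : Fin n → Plane}

/-- The restriction of a polynomial to the `i`-th edge, as a polynomial in the edge parameter. -/
noncomputable def edgePoly (a : Fin n → Plane) (i : Fin n) (p : Poly) : Polynomial ℝ :=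
  aeval (fun c => Polynomial.C (a i c) + Polynomial.C (a (i + 1) c - a i c) * Polynomial.X) p

lemma eval_edgePoly (a : Fin n → Plane) (i : Fin n) (p : Poly) (t : ℝ) :
    (edgePoly a i p).eval t = ev p (AffineMap.lineMap (a i) (a (i + 1)) t) := by
  rw [edgePoly, ← Polynomial.coe_evalRingHom, aeval_def, hom_eval₂, ev, eval, coe_eval₂Hom]
  congr 1
  · ext; simp
  · ext c
    simp [lineMap_apply_coord]; ring

lemma edgePoly_eq_sum (a : Fin n → Plane) (i : Fin n) (p : Poly) :
    edgePoly a i p = ∑ e ∈ p.support, Polynomial.C (p.coeff e) * ∏ c,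
      (Polynomial.C (a i c) + Polynomial.C (a (i + 1) c - a i c) * Polynomial.X) ^ e c := by
  rw [edgePoly, aeval_def, eval₂_eq']
  rfl

lemma natDegree_edgePoly_le (a : Fin n → Plane) (i : Fin n) {p : Poly} {k : ℕ}
    (hp : p ∈ polyLE k) : (edgePoly a i p).natDegree ≤ k := by
  rw [edgePoly_eq_sum]
  refine Polynomial.natDegree_sum_le_of_forall_le _ _ fun e he => ?_
  have hdeg : ∑ c, e c ≤ k := by
    have := mem_polyLE.1 hp e (mem_support_iff.1 he)
    rw [Finsupp.degree_eq_sum] at this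
    exact_mod_cast this
  refine (Polynomial.natDegree_C_mul_le _ _).trans ((Polynomial.natDegree_prod_le _ _).trans
    (le_trans (Finset.sum_le_sum fun c _ => ?_) hdeg))
  have h1 : (Polynomial.C (a i c) +
      Polynomial.C (a (i + 1) c - a i c) * Polynomial.X).natDegree ≤ 1 := by compute_degree
  exact Polynomial.natDegree_pow_le.trans ((Nat.mul_le_mul_left _ h1).trans_eq (mul_one _))

lemma coeff_edgePoly_mem (haF : ∀ i c, a i c ∈ F) (i : Fin n) {p : Poly} (hp : HasCoeffsIn F p)
    (m : ℕ) : (edgePoly a i p).coeff m ∈ F := by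
  have hC : ∀ r ∈ F, Polynomial.C r ∈ (Polynomial.mapRingHom F.subtype).range := fun r hr =>
    ⟨Polynomial.C ⟨r, hr⟩, by simp⟩
  have hX : (Polynomial.X : Polynomial ℝ) ∈ (Polynomial.mapRingHom F.subtype).range :=
    ⟨Polynomial.X, by simp⟩
  have : edgePoly a i p ∈ (Polynomial.mapRingHom F.subtype).range := by
    rw [edgePoly_eq_sum]
    exact sum_mem fun e _ => mul_mem (hC _ (hp e)) (prod_mem fun c _ => pow_mem
      (add_mem (hC _ (haF i c)) (mul_mem (hC _ (F.sub_mem (haF _ c) (haF i c))) hX)) _)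
  obtain ⟨r, hr⟩ := this
  rw [← hr, Polynomial.coe_mapRingHom, Polynomial.coeff_map]
  exact (r.coeff m).2

/-- The integrals over one edge of a field that is there a polynomial of degree at most `k`,
weighted by a polynomial over `F`, are determined by the values at the end points and at `k - 1`
inner points. -/
lemma edge_integral_mem {K : Set Plane} (hK : IsPolygon a K) {k : ℕ} (hk : 1 ≤ k)
    (haF : ∀ i c, a i c ∈ F) {i : Fin n} {ζ : Fin (k - 1) → Plane}
    (hζ : ∀ l, ζ l ∈ openSegment ℝ (a i) (a (i + 1))) (hζi : Function.Injective ζ)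
    (hζF : ∀ l c, ζ l c ∈ F) {g : S → Plane → ℝ}
    (hg : ∀ s, ∃ p ∈ polyLE k, ∀ x ∈ edge a i, g s x = ev p x)
    (h0 : ∀ i, (fun s => g s (a i)) ∈ V) (hζV : ∀ l, (fun s => g s (ζ l)) ∈ V) {q : Poly}
    (hq : HasCoeffsIn F q) :
    (fun s => ∫ t in (0 : ℝ)..1, g s (AffineMap.lineMap (a i) (a (i + 1)) t) *
      ev q (AffineMap.lineMap (a i) (a (i + 1)) t)) ∈ V := by
  simp_rw [openSegment_eq_image_lineMap] at hζ
  choose t ht hζt using hζ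
  choose p hp hgp using hg
  have htF : ∀ l, t l ∈ F := by
    intro l
    obtain ⟨c, hc⟩ : ∃ c, a (i + 1) c - a i c ≠ 0 := by
      by_contra! h
      exact hK.vertex_succ_ne i (by ext c; exact sub_eq_zero.1 (h c))
    have h1 : t l = (ζ l c - a i c) / (a (i + 1) c - a i c) := by
      rw [← hζt l, lineMap_apply_coord]; field_simp; ring
    rw [h1]
    exact F.div_mem (F.sub_mem (hζF l c) (haF i c)) (F.sub_mem (haF _ c) (haF i c))
  -- the interpolation nodes: the two end points and the inner points of the edge
  let τ : Option (Option (Fin (k - 1))) → ℝ := fun o => o.elim 0 fun o' => o'.elim 1 t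
  have hti : Function.Injective t := fun l l' h => hζi (by rw [← hζt l, ← hζt l', h])
  have hτ : Function.Injective τ := by
    rintro (_ | _ | l) (_ | _ | l') h
    · rfl
    · exact absurd h zero_ne_one
    · exact absurd h (ht l').1.ne
    · exact absurd h one_ne_zero
    · rfl
    · exact absurd h (ht l').2.ne'
    · exact absurd h (ht l).1.ne'
    · exact absurd h (ht l).2.ne
    · rw [hti h]
  have hmem : ∀ x ∈ Set.Icc (0 : ℝ) 1, ∀ s,
      (edgePoly a i (p s)).eval x = g s (AffineMap.lineMap (a i) (a (i + 1)) x) := fun x hx s => by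
    rw [eval_edgePoly, hgp s _ (lineMap_mem_edge a i hx)]
  have key := integral_mul_mem_of_nodes (V := V) hτ (G := fun s => edgePoly a i (p s))
    (by
      rintro (_ | _ | l)
      exacts [F.zero_mem, F.one_mem, htF l])
    (fun s => by
      rw [Fintype.card_option, Fintype.card_option, Fintype.card_fin]
      have := natDegree_edgePoly_le a i (hp s)
      omega)
    (by
      rintro (_ | _ | l)
      · convert h0 i using 2 with s
        change (edgePoly a i (p s)).eval 0 = _
        rw [hmem 0 ⟨le_rfl, zero_le_one⟩ s, AffineMap.lineMap_apply_zero]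
      · convert h0 (i + 1) using 2 with s
        change (edgePoly a i (p s)).eval 1 = _
        rw [hmem 1 ⟨zero_le_one, le_rfl⟩ s, AffineMap.lineMap_apply_one]
      · convert hζV l using 2 with s
        change (edgePoly a i (p s)).eval (t l) = _
        rw [hmem _ (Set.Ioo_subset_Icc_self (ht l)) s, hζt])
    (r := edgePoly a i q) (coeff_edgePoly_mem haF i hq)
  convert key using 2 with s
  refine intervalIntegral.integral_congr fun x hx => ?_
  rw [Set.uIcc_of_le zero_le_one] at hx
  simp only [hmem x hx s, eval_edgePoly a i q]

end Edge

/-! ### The virtual element space -/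

section Space

/-- Integration of polynomials against a function in `L²(K)`. -/
noncomputable def intMoment {K : Set Plane} (hK : Bornology.IsBounded K) {u : Plane → ℝ}
    (hu : MemLp u 2 (volume.restrict K)) : Poly →ₗ[ℝ] ℝ where
  toFun q := ∫ x in K, u x * ev q x
  map_add' p q := by
    simp_rw [ev_add, mul_add]
    exact integral_add (integrable_mul_ev hu hK p) (integrable_mul_ev hu hK q)
  map_smul' r q := by
    simp_rw [ev_smul, mul_left_comm (_ : ℝ) r]
    exact integral_const_mul r _

lemma intMoment_apply {K : Set Plane} (hK : Bornology.IsBounded K) {u : Plane → ℝ}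
    (hu : MemLp u 2 (volume.restrict K)) (q : Poly) :
    intMoment hK hu q = ∫ x in K, u x * ev q x := rfl

/-- Integration of polynomials over `K`. -/
noncomputable def intPoly {K : Set Plane} (hK : Bornology.IsBounded K) : Poly →ₗ[ℝ] ℝ :=
  intMoment hK (memLp_of_continuous_of_isBounded (continuous_ev 1) hK 2)

lemma intPoly_apply {K : Set Plane} (hK : Bornology.IsBounded K) (q : Poly) :
    intPoly hK q = ∫ x in K, ev q x := by
  simp [intPoly, intMoment_apply]

variable {n : ℕ} [NeZero n] {a : Fin n → Plane} {K : Set Plane} {k : ℕ}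

lemma integrable_ev (hK : Bornology.IsBounded K) (q : Poly) :
    Integrable (ev q) (volume.restrict K) :=
  integrableOn_of_continuous_of_isBounded (continuous_ev q) hK

lemma integral_mul_ev_sub (hK : Bornology.IsBounded K) {u : Plane → ℝ}
    (hu : MemLp u 2 (volume.restrict K)) (p q : Poly) :
    Integrable (fun x => ev q x * (u x - ev p x)) (volume.restrict K) ∧
      ∫ x in K, ev q x * (u x - ev p x) = intMoment hK hu q - intPoly hK (q * p) := by
  have h : (fun x => ev q x * (u x - ev p x)) = fun x => u x * ev q x - ev (q * p) x := by
    ext x; rw [ev_mul]; ring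
  rw [h, intMoment_apply, intPoly_apply]
  exact ⟨(integrable_mul_ev hu hK q).sub (integrable_ev hK _),
    integral_sub (integrable_mul_ev hu hK q) (integrable_ev hK _)⟩

lemma xPerp_zero (p : Poly) : xPerp p 0 = X 1 * p := by simp [xPerp]

lemma xPerp_one (p : Poly) : xPerp p 1 = -(X 0 * p) := by simp [xPerp]

lemma xPerp_injective : Function.Injective xPerp := by
  rw [← LinearMap.ker_eq_bot, LinearMap.ker_eq_bot']
  intro p hp
  have := congrFun hp 0
  rw [xPerp_zero] at this
  exact (mul_eq_zero.1 this).resolve_left (X_ne_zero _)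

lemma HasCoeffsIn.of_X_mul {F : Subfield ℝ} {p : Poly} {j : Fin 2} (h : HasCoeffsIn F (X j * p)) :
    HasCoeffsIn F p := fun e => by
  have := h (Finsupp.single j 1 + e)
  rwa [coeff_X_mul] at this

/-- A field of the virtual element space together with its boundary values. -/
abbrev FieldWithTrace (a : Fin n → Plane) (K : Set Plane) (k : ℕ) : Type :=
  {s : (Fin 2 → Plane → ℝ) × (Fin 2 → Plane → ℝ) //
    s.1 ∈ enhancedSpace a K k ∧ HasBoundaryValues a K k s.1 s.2}

/-- The functionals of the field that are linear combinations over `F` of the degrees of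
freedom. -/
noncomputable def dofSpan {d₃ d₄ : ℕ} (F : Subfield ℝ) (a : Fin n → Plane) (K : Set Plane) (k : ℕ)
    (z : Fin n → Fin (k - 1) → Plane) (b₃ : Fin d₃ → Fin 2 → Poly) (b₄ : Fin d₄ → Poly) :
    Submodule F (FieldWithTrace a K k → ℝ) :=
  Submodule.span F (Set.range fun (j : DofIndex n k d₃ d₄) (s : FieldWithTrace a K k) =>
    dof a K z b₃ b₄ s.1.1 s.1.2 j)

lemma exists_of_mem_dofSpan {d₃ d₄ : ℕ} {F : Subfield ℝ} {z : Fin n → Fin (k - 1) → Plane}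
    {b₃ : Fin d₃ → Fin 2 → Poly} {b₄ : Fin d₄ → Poly} {f : FieldWithTrace a K k → ℝ}
    (hf : f ∈ dofSpan F a K k z b₃ b₄) : ∃ A : DofIndex n k d₃ d₄ → ℝ, (∀ j, A j ∈ F) ∧
      ∀ s, f s = ∑ j, A j * dof a K z b₃ b₄ s.1.1 s.1.2 j := by
  obtain ⟨A, hA⟩ := (Submodule.mem_span_range_iff_exists_fun F).1 hf
  refine ⟨fun j => A j, fun j => (A j).2, fun s => ?_⟩
  rw [← hA, Finset.sum_apply]
  rfl

/-- The moments of monomials over `K` are rational expressions of the vertex coordinates. -/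
lemma IsPolygon.intPoly_monomial_mem (hK : IsPolygon a K) (hstar : StarShapedBall K)
    {F : Subfield ℝ} (haF : ∀ i c, a i c ∈ F) (e : Fin 2 →₀ ℕ) :
    intPoly hK.isBounded (monomial e 1) ∈ F := by
  obtain ⟨σ, hσ, hpoly, -⟩ := hK.exists_green hstar
  have hσF : σ ∈ F := by
    rcases hσ with rfl | rfl
    exacts [F.one_mem, F.neg_mem F.one_mem]
  -- an antiderivative in the direction of the first coordinate
  set p : Poly := monomial (e + Finsupp.single 0 1) ((e 0 : ℝ) + 1)⁻¹ with hp
  have hpF : HasCoeffsIn F p :=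
    hasCoeffsIn_monomial _ (F.inv_mem (F.add_mem (natCast_mem F _) F.one_mem))
  have hpe : pderiv 0 p = monomial e 1 := by
    have : ((e 0 : ℝ) + 1) ≠ 0 := by positivity
    rw [hp, pderiv_monomial, add_tsub_cancel_right]
    congr 1
    simp [this]
  rw [intPoly_apply, ← hpe, hpoly]
  refine F.sum_mem fun i _ => F.mul_mem (F.mul_mem hσF (F.sub_mem (haF _ _) (haF _ _))) ?_
  simp_rw [← eval_edgePoly]
  exact integral_eval_mem (coeff_edgePoly_mem haF i hpF)

/-- The defining equations of the energy projection, component by component. -/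
lemma IsEnergyProjection.apply_component (hK : Bornology.IsBounded K) {v : Fin 2 → Plane → ℝ}
    {P : Fin 2 → Poly} (hP : IsEnergyProjection K k v P) (hv : ∀ c, IsH1 K (v c)) (c : Fin 2) :
    (∀ q ∈ polyLE k, ∑ j, intMoment hK (memLp_weakPartial (hv c) j) (pderiv j q) =
      ∑ j, intPoly hK (pderiv j q * pderiv j (P c))) ∧
    intMoment hK (hv c).1 1 = intPoly hK (P c) := by
  constructor
  · intro q hq
    have h := hP.2.1 (Pi.single c q) fun i => by
      rcases eq_or_ne i c with rfl | hi
      · rwa [Pi.single_eq_same]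
      · rw [Pi.single_eq_of_ne hi]; exact Submodule.zero_mem _
    have h1 : ∀ x, ∑ i, ∑ j, ev (pderiv j ((Pi.single c q : Fin 2 → Poly) i)) x *
        (weakPartial K j (v i) x - ev (pderiv j (P i)) x) =
        ∑ j, ev (pderiv j q) x * (weakPartial K j (v c) x - ev (pderiv j (P c)) x) := fun x => by
      rw [Finset.sum_eq_single c (fun i _ hi => by simp [Pi.single_eq_of_ne hi])
        (fun h => absurd (Finset.mem_univ c) h), Pi.single_eq_same]
    simp_rw [h1] at h
    rw [integral_finsetSum _ fun j _ =>
      (integral_mul_ev_sub hK (memLp_weakPartial (hv c) j) _ _).1] at h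
    simp_rw [(integral_mul_ev_sub hK (memLp_weakPartial (hv c) _) _ _).2] at h
    rwa [Finset.sum_sub_distrib, sub_eq_zero] at h
  · have h := hP.2.2.2 (Pi.single c 1) fun i => by
      rcases eq_or_ne i c with rfl | hi
      · rw [Pi.single_eq_same]; exact monomial_mem_polyLE (by simp) 1
      · rw [Pi.single_eq_of_ne hi]; exact Submodule.zero_mem _
    have h1 : ∀ x, ∑ i, ev ((Pi.single c 1 : Fin 2 → Poly) i) x *
        (v i x - ev (P i) x - ev ((0 : Fin 2 → Poly) i) x) =
        ev 1 x * (v c x - ev (P c) x) := fun x => by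
      rw [Finset.sum_eq_single c (fun i _ hi => by simp [Pi.single_eq_of_ne hi])
        (fun h => absurd (Finset.mem_univ c) h), Pi.single_eq_same]
      simp
    simp_rw [h1] at h
    rwa [(integral_mul_ev_sub hK (hv c).1 _ _).2, one_mul, sub_eq_zero] at h

lemma integral_sum_mul_xPerp (hK : Bornology.IsBounded K) {v : Fin 2 → Plane → ℝ}
    (hv : ∀ c, MemLp (v c) 2 (volume.restrict K)) (g : Poly) :
    ∫ x in K, ∑ i, v i x * ev (xPerp g i) x = rotMoment (fun c => intMoment hK (hv c)) g := by
  rw [integral_finsetSum _ fun i _ => integrable_mul_ev (hv i) hK _, Fin.sum_univ_two,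
    xPerp_zero, xPerp_one, rotMoment_apply, sub_eq_add_neg, ← map_neg]
  rfl

/-- The enhancement property in terms of the functionals `rotMoment`. -/
lemma rotMoment_eq_of_enhanced (hK : Bornology.IsBounded K) {v : Fin 2 → Plane → ℝ}
    {P : Fin 2 → Poly} (hv : ∀ c, MemLp (v c) 2 (volume.restrict K))
    (horth : ∀ g ∈ gPerpOrth K k, ∫ x in K, ∑ i, (v i x - ev (P i) x) * ev (g i) x = 0)
    {g : Poly} (hg : g ∈ polyLE ((k : ℤ) - 1))
    (hgo : ∀ h ∈ polyLE ((k : ℤ) - 3), rotForm (intPoly hK) g h = 0) :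
    rotMoment (fun c => intMoment hK (hv c)) g =
      rotMoment (fun c => mulForm (intPoly hK) (P c)) g := by
  have hmem : xPerp g ∈ gPerpOrth K k := by
    refine ⟨Submodule.mem_map_of_mem hg, ?_⟩
    rintro _ ⟨h, hh, rfl⟩
    have h0 := hgo h (by rwa [sub_sub, show (2 : ℤ) + 1 = 3 by norm_num] at hh)
    rw [rotForm_apply, Fin.sum_univ_two, intPoly_apply, intPoly_apply,
      ← integral_add (integrable_ev hK _) (integrable_ev hK _)] at h0
    rw [← h0]
    refine integral_congr_ae (Eventually.of_forall fun x => ?_)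
    simp only [Fin.sum_univ_two, xPerp_zero, xPerp_one, ← ev_mul, ← ev_add]
    congr 1
    ring
  have h1 := horth _ hmem
  have hP : ∀ c, MemLp (ev (P c)) 2 (volume.restrict K) := fun c =>
    memLp_of_continuous_of_isBounded (continuous_ev _) hK 2
  rw [show (fun x => ∑ i, (v i x - ev (P i) x) * ev (xPerp g i) x) = fun x =>
      ∑ i, v i x * ev (xPerp g i) x - ∑ i, ev (P i) x * ev (xPerp g i) x by
    ext x; rw [← Finset.sum_sub_distrib]; exact Finset.sum_congr rfl fun i _ => sub_mul _ _ _,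
    integral_sub (integrable_finsetSum _ fun i _ => integrable_mul_ev (hv i) hK _)
      (integrable_finsetSum _ fun i _ => integrable_mul_ev (hP i) hK _),
    integral_sum_mul_xPerp hK hv, integral_sum_mul_xPerp hK hP, sub_eq_zero] at h1
  rw [h1]
  simp only [rotMoment_apply, intMoment_apply, mulForm_apply, intPoly_apply, ev_mul]

variable {d₃ d₄ : ℕ}

/-- Every moment of degree at most `k` of a component of the field is a linear combination of the
degrees of freedom, over the data field if the test polynomial is. -/
theorem intMoment_mem_dofSpan (hK : IsPolygon a K) (hstar : StarShapedBall K) (hk : 2 ≤ k)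
    (z : Fin n → Fin (k - 1) → Plane) (hz : ∀ i l, z i l ∈ openSegment ℝ (a i) (a (i + 1)))
    (hz_inj : ∀ i, Function.Injective (z i)) (b₃ : Fin d₃ → Fin 2 → Poly)
    (hb₃ : Submodule.span ℝ (Set.range b₃) = gPerp ((k : ℤ) - 2)) (b₄ : Fin d₄ → Poly)
    (hb₄ : Submodule.span ℝ (insert 1 (Set.range b₄)) = polyLE ((k : ℤ) - 1))
    {q : Poly} (hq : q ∈ polyLE k) (hqF : HasCoeffsIn (dataField a z b₃ b₄) q) (c : Fin 2) :
    (fun s : FieldWithTrace a K k => intMoment hK.isBounded (s.2.1.1.1 c).1 q) ∈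
      dofSpan (dataField a z b₃ b₄) a K k z b₃ b₄ := by
  set F := dataField a z b₃ b₄
  set V := dofSpan F a K k z b₃ b₄
  have hb := hK.isBounded
  have hdofV : ∀ j, (fun s : FieldWithTrace a K k => dof a K z b₃ b₄ s.1.1 s.1.2 j) ∈ V :=
    fun j => Submodule.subset_span ⟨j, rfl⟩
  have haF : ∀ i c, a i c ∈ F := fun i c => Subfield.subset_closure (Or.inl ⟨i, c, rfl⟩)
  have hzF : ∀ i l c, z i l c ∈ F := fun i l c =>
    Subfield.subset_closure (Or.inr (Or.inl ⟨i, l, c, rfl⟩))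
  have hb₃F : ∀ j c, HasCoeffsIn F (b₃ j c) := fun j c e =>
    Subfield.subset_closure (Or.inr (Or.inr (Or.inl ⟨j, c, e, rfl⟩)))
  have hb₄F : ∀ j, HasCoeffsIn F (b₄ j) := fun j e =>
    Subfield.subset_closure (Or.inr (Or.inr (Or.inr ⟨j, e, rfl⟩)))
  have hJF := hK.intPoly_monomial_mem hstar haF
  have hJ0 : ∀ p, 0 ≤ intPoly hb (p * p) := fun p => by
    rw [intPoly_apply]
    exact integral_nonneg fun x => by rw [ev_mul]; exact mul_self_nonneg _
  have hJ : ∀ p, intPoly hb (p * p) = 0 → p = 0 := fun p h =>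
    eq_zero_of_integral_mul_self_eq_zero hK.isOpen hK.nonempty hb (by rwa [intPoly_apply] at h)
  -- the generators of `G_{k-2}^⊥` are the fields `x^⊥ β j`
  have hβex : ∀ j, ∃ β ∈ polyLE ((k : ℤ) - 2 - 1), xPerp β = b₃ j := fun j => by
    have : b₃ j ∈ gPerp ((k : ℤ) - 2) := hb₃ ▸ Submodule.subset_span ⟨j, rfl⟩
    exact this
  choose β hβm hβ using hβex
  have hβspan : Submodule.span ℝ (Set.range β) = polyLE ((k : ℤ) - 3) := by
    apply Submodule.map_injective_of_injective xPerp_injective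
    rw [Submodule.map_span, ← Set.range_comp, show xPerp ∘ β = b₃ from funext hβ, hb₃, gPerp,
      sub_sub, show (2 : ℤ) + 1 = 3 by norm_num]
  have hβF : ∀ j, HasCoeffsIn F (β j) := fun j => by
    have := hb₃F j 0
    rw [← hβ j, xPerp_zero] at this
    exact this.of_X_mul
  obtain ⟨σ, hσ, -, hgreen⟩ := hK.exists_green hstar
  have hσF : σ ∈ F := by
    rcases hσ with rfl | rfl
    exacts [F.one_mem, F.neg_mem F.one_mem]
  have hNF : ∀ i j, edgeNormal a i j ∈ F := fun i j => by
    fin_cases j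
    exacts [F.sub_mem (haF _ _) (haF _ _), F.neg_mem (F.sub_mem (haF _ _) (haF _ _))]
  choose D hDm hD using fun s : FieldWithTrace a K k => s.2.1.1.2.2.2
  choose P hPen hPorth using fun s : FieldWithTrace a K k => s.2.1.2
  refine moment_mem (μ := fun s c => intMoment hb (s.2.1.1.1 c).1)
    (dv := fun s c j => intMoment hb (memLp_weakPartial (s.2.1.1.1 c) j)) hJF hJ0 hJ
    (by exact_mod_cast hk) ?_ hDm ?_ hb₄ hb₄F ?_ hβspan hβF ?_ (P := P)
    (fun s c => (hPen s).1 c) (fun s c => ((hPen s).apply_component hb s.2.1.1.1 c).1)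
    (fun s c => ((hPen s).apply_component hb s.2.1.1.1 c).2)
    (fun s g hg hgo => rotMoment_eq_of_enhanced hb (fun c => (s.2.1.1.1 c).1)
      (hPorth s) hg hgo) hq hqF c
  · intro c j q hqF
    have h1 := V.sum_mem (t := Finset.univ) fun i _ => mul_mem_of_mem (F.mul_mem hσF (hNF i j))
      (edge_integral_mem (V := V) hK (one_le_two.trans hk) haF (hz i) (hz_inj i) (hzF i)
        (g := fun s => s.1.2 c) (fun s => (s.2.2 c).1.2 i)
        (fun i => hdofV (Sum.inl (Sum.inl (i, c))))
        (fun l => hdofV (Sum.inl (Sum.inr ((i, l), c)))) hqF)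
    convert h1 using 1
    ext s
    rw [intMoment_apply, intMoment_apply,
      hgreen k _ _ (s.2.1.1.1 c) (s.2.2 c).2 (s.2.2 c).1 q j, Finset.sum_apply, sub_add_cancel]
  · intro s q
    simp_rw [intMoment_apply]
    rw [← integral_finsetSum _ fun j _ =>
      integrable_mul_ev (memLp_weakPartial (s.2.1.1.1 j) j) hb q, intPoly_apply]
    refine integral_congr_ae ?_
    filter_upwards [hD s] with x hx
    rw [ev_mul, ← hx, weakDiv, Finset.sum_mul]
  · intro j
    convert hdofV (Sum.inr (Sum.inr j)) using 2 with s
    rw [intPoly_apply]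
    refine integral_congr_ae ?_
    filter_upwards [hD s] with x hx
    rw [ev_mul, hx]
  · intro j
    convert hdofV (Sum.inr (Sum.inl j)) using 2 with s
    rw [← integral_sum_mul_xPerp hb, hβ j]
    rfl

/-- A polynomial valued functional with coefficients in the span of the degrees of freedom is a
combination of the degrees of freedom with fixed polynomials over `F`. -/
lemma exists_basis_of_hasCoeffsMem {F : Subfield ℝ} {z : Fin n → Fin (k - 1) → Plane}
    {b₃ : Fin d₃ → Fin 2 → Poly} {b₄ : Fin d₄ → Poly} {m : ℤ} {P : FieldWithTrace a K k → Poly}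
    (hP : ∀ s, P s ∈ polyLE m) (hc : HasCoeffsMem (dofSpan F a K k z b₃ b₄) P) :
    ∃ B : DofIndex n k d₃ d₄ → Poly, (∀ j, B j ∈ polyLE m ∧ HasCoeffsIn F (B j)) ∧
      ∀ s, P s = ∑ j, dof a K z b₃ b₄ s.1.1 s.1.2 j • B j := by
  choose A hAF hA using fun e => exists_of_mem_dofSpan (hc e)
  refine ⟨fun j => ∑ e : exps m, monomial (e : Fin 2 →₀ ℕ) (A e j), fun j => ⟨?_, fun e' => ?_⟩,
    fun s => ?_⟩
  · exact Submodule.sum_mem _ fun e _ => monomial_mem_polyLE (mem_exps.1 e.2) _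
  · rw [coeff_sum]
    exact F.sum_mem fun e _ => hasCoeffsIn_monomial _ (hAF _ _) e'
  · conv_lhs => rw [eq_sum_exps (hP s)]
    simp_rw [Finset.smul_sum]
    rw [Finset.sum_comm]
    refine Finset.sum_congr rfl fun e _ => ?_
    rw [hA, Finset.sum_smul]
    refine Finset.sum_congr rfl fun j _ => ?_
    rw [smul_monomial, smul_monomial, smul_eq_mul, smul_eq_mul, mul_one, mul_comm]

end Space

end VEM

theorem mainTheorem5 {n : ℕ} [NeZero n] (a : Fin n → VEM.Plane) (K : Set VEM.Plane)
    (hK : VEM.IsPolygon a K) (hstar : VEM.StarShapedBall K) (k : ℕ) (hk : 2 ≤ k)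
    (z : Fin n → Fin (k - 1) → VEM.Plane)
    (hz : ∀ i l, z i l ∈ openSegment ℝ (a i) (a (i + 1)))
    (hz_inj : ∀ i, Function.Injective (z i))
    {d₃ d₄ : ℕ} (b₃ : Fin d₃ → Fin 2 → VEM.Poly)
    (hb₃ : Submodule.span ℝ (Set.range b₃) = VEM.gPerp ((k : ℤ) - 2))
    (b₄ : Fin d₄ → VEM.Poly)
    (hb₄ : Submodule.span ℝ (insert 1 (Set.range b₄)) = VEM.polyLE ((k : ℤ) - 1)) :
    (∃ B : VEM.DofIndex n k d₃ d₄ → Fin 2 → VEM.Poly,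
      (∀ j c, B j c ∈ VEM.polyLE k ∧ ∀ m, (B j c).coeff m ∈ VEM.dataField a z b₃ b₄) ∧
      ∀ v ∈ VEM.enhancedSpace a K k, ∀ g, VEM.HasBoundaryValues a K k v g →
        VEM.IsL2Projection K k v (∑ j, VEM.dof a K z b₃ b₄ v g j • B j)) ∧
    (∀ q : Fin 2 → VEM.Poly, (∀ c, q c ∈ VEM.polyLE k) →
      ∃ A : VEM.DofIndex n k d₃ d₄ → ℝ,
        ((∀ c m, (q c).coeff m ∈ VEM.dataField a z b₃ b₄) →
          ∀ j, A j ∈ VEM.dataField a z b₃ b₄) ∧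
        ∀ v ∈ VEM.enhancedSpace a K k, ∀ g, VEM.HasBoundaryValues a K k v g →
          ∫ x in K, ∑ c, v c x * VEM.ev (q c) x = ∑ j, A j * VEM.dof a K z b₃ b₄ v g j) := by
  have hb := hK.isBounded
  have haF : ∀ i c, a i c ∈ VEM.dataField a z b₃ b₄ := fun i c =>
    Subfield.subset_closure (Or.inl ⟨i, c, rfl⟩)
  have hJF := hK.intPoly_monomial_mem hstar haF
  have hmoment : ∀ (c : Fin 2) (e : VEM.exps k),
      (fun s : VEM.FieldWithTrace a K k =>
        VEM.intMoment hb (s.2.1.1.1 c).1 (MvPolynomial.monomial (e : Fin 2 →₀ ℕ) 1)) ∈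
        VEM.dofSpan (VEM.dataField a z b₃ b₄) a K k z b₃ b₄ := fun c e =>
    VEM.intMoment_mem_dofSpan hK hstar hk z hz hz_inj b₃ hb₃ b₄ hb₄
      (VEM.monomial_mem_polyLE (VEM.mem_exps.1 e.2) 1)
      (VEM.hasCoeffsIn_monomial _ (Subfield.one_mem _)) c
  constructor
  · -- the projection is found from the moments by inverting the Gram matrix of the monomials
    have hJ : ∀ p, VEM.mulForm (VEM.intPoly hb) p p = 0 → p = 0 := fun p h =>
      VEM.eq_zero_of_integral_mul_self_eq_zero hK.isOpen hK.nonempty hb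
        (by rwa [VEM.mulForm_apply, VEM.intPoly_apply] at h)
    choose P hPm hP using fun (c : Fin 2) (s : VEM.FieldWithTrace a K k) =>
      VEM.exists_mem_forall_eq (VEM.polyLE k) hJ (VEM.intMoment hb (s.2.1.1.1 c).1)
    have hPc : ∀ c, VEM.HasCoeffsMem
        (VEM.dofSpan (VEM.dataField a z b₃ b₄) a K k z b₃ b₄) (P c) := fun c => by
      refine VEM.hasCoeffsMem_of_system (ι := VEM.exps k) (m := k)
        (L := fun e => VEM.mulForm (VEM.intPoly hb) (MvPolynomial.monomial (e : Fin 2 →₀ ℕ) 1))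
        (fun i e => VEM.map_mul_mem hJF (VEM.hasCoeffsIn_monomial _ (Subfield.one_mem _))
          (VEM.hasCoeffsIn_monomial _ (Subfield.one_mem _))) (fun p hp h => ?_) (hPm c)
        fun e => ?_
      · have : VEM.polyLE k ≤ LinearMap.ker (VEM.mulForm (VEM.intPoly hb) p) :=
          VEM.polyLE_induction fun e he => by
            have := h ⟨e, VEM.mem_exps.2 he⟩
            rwa [VEM.mulForm_apply, mul_comm] at this
        exact hJ p (this hp)
      · convert hmoment c e using 2 with s
        rw [← hP c s _ (VEM.monomial_mem_polyLE (VEM.mem_exps.1 e.2) 1), VEM.mulForm_apply,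
          VEM.mulForm_apply, mul_comm]
    choose B hB hBP using fun c => VEM.exists_basis_of_hasCoeffsMem (hPm c) (hPc c)
    refine ⟨fun j c => B c j, fun j c => hB c j, fun v hv g hg => ?_⟩
    have hsum : ∑ j, VEM.dof a K z b₃ b₄ v g j • (fun c => B c j) =
        fun c => P c ⟨(v, g), hv, hg⟩ := by
      ext1 c
      rw [hBP c ⟨(v, g), hv, hg⟩, Finset.sum_apply]
      rfl
    rw [hsum]
    refine ⟨fun c => hPm c _, fun q hq => ?_⟩
    rw [integral_finsetSum _ fun c _ => (VEM.integral_mul_ev_sub hb (hv.1.1 c).1 _ _).1]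
    refine Finset.sum_eq_zero fun c _ => ?_
    rw [(VEM.integral_mul_ev_sub hb (hv.1.1 c).1 _ _).2, sub_eq_zero,
      ← hP c ⟨(v, g), hv, hg⟩ _ (hq c), VEM.mulForm_apply, mul_comm]
  · intro q hq
    choose A hAF hA using fun c e => VEM.exists_of_mem_dofSpan (hmoment c e)
    refine ⟨fun j => ∑ c, ∑ e : VEM.exps k, (q c).coeff (e : Fin 2 →₀ ℕ) * A c e j,
      fun hqF j => sum_mem fun c _ => sum_mem fun e _ => mul_mem (hqF c e) (hAF c e j),
      fun v hv g hg => ?_⟩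
    rw [integral_finsetSum _ fun c _ => VEM.integrable_mul_ev (hv.1.1 c).1 hb _]
    simp_rw [Finset.sum_mul]
    rw [Finset.sum_comm]
    refine Finset.sum_congr rfl fun c _ => ?_
    rw [Finset.sum_comm, ← VEM.intMoment_apply hb (hv.1.1 c).1 (q c)]
    conv_lhs => rw [VEM.eq_sum_exps (hq c)]
    rw [map_sum]
    refine Finset.sum_congr rfl fun e _ => ?_
    rw [map_smul, smul_eq_mul, hA c e ⟨(v, g), hv, hg⟩, Finset.mul_sum]
    exact Finset.sum_congr rfl fun j _ => (mul_assoc _ _ _).symm
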